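/- Let $r\ge 0$ and $d\ge 1$ be integers. A $\mathbb{Z}^{rd}$-system $(X,\Sigma,\mu,T)$ is a standard Borel probability space $(X,\Sigma,\mu)$ with an action $T:\mathbb{Z}^{rd}\curvearrowright X$ by measurable $\mu$-preserving maps. Write $\mathbb{Z}^{rd}=(\mathbb{Z}^r)^d$, let $\alpha_i:\mathbb{Z}^r\to\mathbb{Z}^{rd}$ be the embedding as the $i$-th block, and put $T_i^n:=T^{\alpha_i(n)}$ for $1\le i\le d$, $n\in\mathbb{Z}^r$. For a subgroup $\Gamma\le\mathbb{Z}^{rd}$ let $$\Sigma^{T|_\Gamma}:=\{A\in\Sigma:\ \mu(T^\gamma A\,\triangle\, A)=0\ \text{ for all } \gamma\in\Gamma\},$$ and write $\Sigma^{T_1}$ and $\Sigma^{T_i=T_1}$ for this $\sigma$-algebra when $\Gamma=\alpha_1(\mathbb{Z}^r)$ and $\Gamma=\{\alpha_i(n)-\alpha_1(n):n\in\mathbb{Z}^r\}$ respectively. A tuple $(\Xi_1,\dots,\Xi_d)$ of $T$-invariant $\sigma$-subalgebras of $\Sigma$, each containing all $\mu$-null sets of $\Sigma$, is called characteristic if for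 all $f_1,\dots,f_d\in L^\infty(\mu)$ (complex-valued), every Følner sequence $(I_N)_{N\ge1}$ of finite subsets of $\mathbb{Z}^r$ and every sequence $(a_N)_{N\ge1}$ in $\mathbb{Z}^r$, $$\frac{1}{|I_N|}\sum_{n\in a_N+I_N}\prod_{i=1}^d f_i\circ T_i^n-\frac{1}{|I_N|}\sum_{n\in a_N+I_N}\prod_{i=1}^d \mathsf{E}_\mu[f_i\,|\,\Xi_i]\circ T_i^n\longrightarrow 0\quad\text{in } L^2(\mu)\text{ as }N\to\infty.$$ The system is called pleasant if $\big(\Sigma^{T_1}\vee\bigvee_{i=2}^d\Sigma^{T_i=T_1},\ \Sigma,\dots,\Sigma\big)$ is characteristic. **Proposition.** Every $\mathbb{Z}^{rd}$-system $(X,\Sigma,\mu,T)$ admits a pleasant extension: there are a pleasant $\mathbb{Z}^{rd}$-system $(\tilde X,\tilde\Sigma,\tilde\mu,\tilde T)$ and a measurable map $\psi:\tilde X\to X$ with $\psi_*\tilde\mu=\mu$ and $\psi\circ\tilde T^g=T^g\circ\psi$ for all $g\in\mathbb{Z}^{rd}$. -/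

import Mathlib

open MeasureTheory Filter Topology

universe u

/-- The acting group `ℤ^{rd}`, written as `(ℤ^r)^d`. -/
abbrev ZGroup (r d : ℕ) : Type := Fin d → Fin r → ℤ

/-- The embedding `α_i` of `ℤ^r` into `ℤ^{rd}` as the `i`-th block (blocks are numbered from `0`). -/
def blockEmb {r d : ℕ} (i : Fin d) : (Fin r → ℤ) →+ ZGroup r d :=
  AddMonoidHom.single (fun _ : Fin d => Fin r → ℤ) i

/-- `T` is a probability-preserving action of `ℤ^{rd}` on `(X, μ)`
(`μ` is separately assumed to be a probability measure). -/
structure IsPreservingAction {r d : ℕ} {X : Type u} [MeasurableSpace X] (μ : Measure X)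
    (T : ZGroup r d → X → X) : Prop where
  map_zero : ∀ x, T 0 x = x
  map_add : ∀ g h x, T (g + h) x = T g (T h x)
  measurePreserving : ∀ g, MeasurePreserving (T g) μ μ

/-- `ψ` is a probability-preserving intertwining map from `(Y, ν, S)` to `(X, μ, T)`;
equivalently, it presents `(Y, ν, S)` as an extension of `(X, μ, T)`. -/
structure IsExtensionMap {r d : ℕ} {Y X : Type u} [MeasurableSpace Y] [MeasurableSpace X]
    (ν : Measure Y) (S : ZGroup r d → Y → Y) (μ : Measure X) (T : ZGroup r d → X → X)
    (ψ : Y → X) : Prop where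
  measurePreserving : MeasurePreserving ψ ν μ
  intertwines : ∀ g y, ψ (S g y) = T g (ψ y)

/-- The isotropy factor of a subgroup `Γ`: the σ-algebra of all measurable sets
that every `T^γ`, `γ ∈ Γ`, fixes up to a `μ`-null set. -/
@[reducible] def isotropyFactor {r d : ℕ} {X : Type u} [MeasurableSpace X] (μ : Measure X)
    (T : ZGroup r d → X → X) (Γ : AddSubgroup (ZGroup r d)) : MeasurableSpace X where
  MeasurableSet' A := MeasurableSet A ∧ ∀ γ ∈ Γ, T γ ⁻¹' A =ᵐ[μ] A
  measurableSet_empty := ⟨MeasurableSet.empty, fun _ _ => by simp⟩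
  measurableSet_compl A hA := ⟨hA.1.compl, fun γ hγ => (hA.2 γ hγ).compl⟩
  measurableSet_iUnion A hA := ⟨MeasurableSet.iUnion fun n => (hA n).1, fun γ hγ => by
    rw [Set.preimage_iUnion]
    exact Filter.EventuallyEq.countable_iUnion fun n => (hA n).2 γ hγ⟩

/-- A factor of `(X, μ, T)`, as a σ-algebra: a `T`-invariant sub-σ-algebra
that is `μ`-complete inside the ambient σ-algebra. -/
structure IsFactorAlgebra {r d : ℕ} {X : Type u} [m₀ : MeasurableSpace X] (μ : Measure X)
    (T : ZGroup r d → X → X) (Ξ : MeasurableSpace X) : Prop where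
  le : Ξ ≤ m₀
  invariant : ∀ g A, MeasurableSet[Ξ] A → MeasurableSet[Ξ] (T g ⁻¹' A)
  complete : ∀ A, MeasurableSet[m₀] A → μ A = 0 → MeasurableSet[Ξ] A

/-- The nonconventional average `|I|⁻¹ ∑_{n ∈ a + I} ∏_i f_i ∘ T_i^n`. -/
noncomputable def nonconvAverage {r d : ℕ} {X : Type u} (T : ZGroup r d → X → X)
    (I : Finset (Fin r → ℤ)) (a : Fin r → ℤ) (f : Fin d → X → ℂ) (x : X) : ℂ :=
  (I.card : ℂ)⁻¹ * ∑ n ∈ I, ∏ i, f i (T (blockEmb i (a + n)) x)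

/-- `Ξ = (Ξ_i)_i` is a tuple of characteristic factors for the nonconventional averages:
replacing every `f_i` by its conditional expectation on `Ξ_i` does not change the asymptotic
behaviour in `L²(μ)`, for all essentially bounded functions,
all Følner sequences and all base-point sequences. -/
structure IsCharacteristicTuple {r d : ℕ} {X : Type u} [MeasurableSpace X] (μ : Measure X)
    (T : ZGroup r d → X → X) (Ξ : Fin d → MeasurableSpace X) : Prop where
  isFactorAlgebra : ∀ i, IsFactorAlgebra μ T (Ξ i)
  tendsto : ∀ f : Fin d → X → ℂ, (∀ i, MemLp (f i) ⊤ μ) →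
    ∀ I : ℕ → Finset (Fin r → ℤ),
      IsAddFoelner (Fin r → ℤ) (Measure.count : Measure (Fin r → ℤ)) atTop
        (fun N => (I N : Set (Fin r → ℤ))) →
    ∀ a : ℕ → Fin r → ℤ,
      Tendsto (fun N => eLpNorm (fun x => nonconvAverage T (I N) (a N) f x
        - nonconvAverage T (I N) (a N) (fun i => μ[f i | Ξ i]) x) 2 μ) atTop (𝓝 0)

/-- The σ-algebra `Σ^{T_1} ∨ ⋁_{i ≥ 2} Σ^{T_i = T_1}`; the first action has index `0`. -/
@[reducible] def pleasantFactor {r d : ℕ} [NeZero d] {X : Type u} [MeasurableSpace X]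
    (μ : Measure X) (T : ZGroup r d → X → X) : MeasurableSpace X :=
  isotropyFactor μ T (blockEmb (r := r) (0 : Fin d)).range ⊔
    ⨆ (i : Fin d) (_ : i ≠ 0), isotropyFactor μ T (blockEmb (r := r) i - blockEmb 0).range

/-- A system is pleasant if `(Σ^{T_1} ∨ ⋁_{i ≥ 2} Σ^{T_i = T_1}, Σ, …, Σ)` is a tuple of
characteristic factors. -/
def IsPleasant {r d : ℕ} [NeZero d] {X : Type u} [m₀ : MeasurableSpace X] (μ : Measure X)
    (T : ZGroup r d → X → X) : Prop :=
  IsCharacteristicTuple μ T (fun i => if i = 0 then pleasantFactor μ T else m₀)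

/-!
The pleasant extension is an inverse limit of Host cubes.

Write `ℤ^{rd}` as the direct sum of the images of the `d` maps `direction 0 = α_0` and
`direction k = α_0 - α_k`, for `k ≠ 0`; their isotropy factors are the ones that generate the
pleasant factor. The cube of a system in direction `k` is the relatively independent square of
the measure over the isotropy factor of `direction k`, with the side transformations as action:
`T^g` acts on the first coordinate, and on the second coordinate only the part of `g` complementary
to `direction k` acts. Iterating over all directions gives a system whose points have `2^d`
vertices. It extends the original system through the first vertex, while every other vertex is
fixed by one of the directions. Hence the tensor power of a function `u` over the vertices is `u`
at the first vertex times a function measurable for the pleasant factor of the iterated cube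
(`MPSystem.exists_cubesLift_eq_mul`).

The integral of this tensor power is the cube form of `u`. Van der Corput's inequality, applied
once for each of the functions `f_i` with `i ≠ 0` and followed by the mean ergodic theorem, bounds
the `L²` norms of the nonconventional averages by a root of the cube form of `f_0`
(`MPSystem.eventually_integral_norm_directionAverage_sq_le`). A system is therefore pleasant as
soon as every bounded `f` with `E[f | pleasant factor] = 0` has vanishing cube form
(`MPSystem.isPleasant_of_cubeForm_eq_zero`).

This condition holds in the inverse limit `Y` of the tower in which each system is the iterated
cube of its predecessor. There `f` is close in `L¹` to the lift of some `φ` from a stage `B` of the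
tower, so the cube form of `f` is close to that of `φ`. The latter is an integral over the next
stage, which is the iterated cube of `B` and also a factor of `Y`; as an integral over `Y` it pairs
the lift of `φ` with a function measurable for the pleasant factor, and replacing `φ` by `f` again
costs little and gives zero (`MPSystem.norm_cubeForm_le_of_approx` and
`MPSystem.exists_extension_cubeForm_eq_zero`). The inverse limit of a tower of standard Borel
systems exists by the Ionescu-Tulcea theorem (`MPSystem.exists_inverseLimit`).
-/

open scoped symmDiff

/-! ### Følner sequences and averages -/

/-- The average of `u` over the finite set `J` (zero when `J` is empty). -/
noncomputable def finAvg {V E : Type*} [AddCommGroup E] [Module ℝ E] (J : Finset V) (u : V → E) : E :=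
  (J.card : ℝ)⁻¹ • ∑ n ∈ J, u n

section FinAvg

variable {V E : Type*} [NormedAddCommGroup E] [NormedSpace ℝ E]

lemma norm_finAvg_le {J : Finset V} {u : V → E} {C : ℝ} (hC : 0 ≤ C) (hu : ∀ n ∈ J, ‖u n‖ ≤ C) :
    ‖finAvg J u‖ ≤ C := by
  rw [finAvg, norm_smul, norm_inv, Real.norm_natCast]
  rcases J.eq_empty_or_nonempty with rfl | hJ
  · simpa using hC
  · have hc : (0 : ℝ) < J.card := by exact_mod_cast hJ.card_pos
    rw [inv_mul_le_iff₀ hc]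
    simpa using norm_sum_le_of_le J hu

lemma finAvg_const {J : Finset V} (hJ : J.Nonempty) (c : E) : finAvg J (fun _ => c) = c := by
  have hc : (J.card : ℝ) ≠ 0 := by exact_mod_cast hJ.card_pos.ne'
  rw [finAvg, Finset.sum_const, ← Nat.cast_smul_eq_nsmul ℝ, smul_smul, inv_mul_cancel₀ hc, one_smul]

lemma finAvg_mono {J : Finset V} {u v : V → ℝ} (h : ∀ n ∈ J, u n ≤ v n) :
    finAvg J u ≤ finAvg J v := by
  simp only [finAvg, smul_eq_mul]
  exact mul_le_mul_of_nonneg_left (Finset.sum_le_sum h) (by positivity)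

lemma finAvg_sub (J : Finset V) (u v : V → E) :
    finAvg J (fun n => u n - v n) = finAvg J u - finAvg J v := by
  simp [finAvg, Finset.sum_sub_distrib, smul_sub]

lemma finAvg_add (J : Finset V) (u v : V → E) :
    finAvg J (fun n => u n + v n) = finAvg J u + finAvg J v := by
  simp [finAvg, Finset.sum_add_distrib, smul_add]

lemma finAvg_comm {W : Type*} (J : Finset V) (F : Finset W) (u : V → W → E) :
    finAvg J (fun n => finAvg F (u n)) = finAvg F (fun h => finAvg J (fun n => u n h)) := by
  simp only [finAvg, ← Finset.smul_sum, smul_smul]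
  rw [Finset.sum_comm, mul_comm]

lemma map_finAvg {E' : Type*} [NormedAddCommGroup E'] [NormedSpace ℝ E'] (l : E →ₗ[ℝ] E')
    (J : Finset V) (u : V → E) : l (finAvg J u) = finAvg J (fun n => l (u n)) := by
  simp [finAvg, map_sum]

lemma finAvg_mul_left (J : Finset V) (c : ℂ) (u : V → ℂ) :
    finAvg J (fun n => c * u n) = c * finAvg J u := by
  simp [finAvg, ← Finset.mul_sum, mul_left_comm]

lemma norm_finAvg_sq_le (J : Finset V) (u : V → E) :
    ‖finAvg J u‖ ^ 2 ≤ finAvg J (fun n => ‖u n‖ ^ 2) := by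
  rcases J.eq_empty_or_nonempty with rfl | hJ
  · simp [finAvg]
  have hc : (0 : ℝ) < J.card := by exact_mod_cast hJ.card_pos
  have h1 : ‖∑ n ∈ J, u n‖ ^ 2 ≤ J.card * ∑ n ∈ J, ‖u n‖ ^ 2 :=
    (pow_le_pow_left₀ (norm_nonneg _) (norm_sum_le _ _) 2).trans sq_sum_le_card_mul_sum_sq
  rw [finAvg, finAvg, norm_smul, norm_inv, Real.norm_natCast, smul_eq_mul, mul_pow, inv_pow,
    inv_mul_le_iff₀ (by positivity)]
  calc _ ≤ _ := h1
    _ = _ := by field_simp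

lemma finAvg_pow_le {J : Finset V} (hJ : J.Nonempty) {u : V → ℝ} (hu : ∀ n ∈ J, 0 ≤ u n) (m : ℕ) :
    finAvg J u ^ m ≤ finAvg J (fun n => u n ^ m) := by
  have hc : (J.card : ℝ) ≠ 0 := by exact_mod_cast hJ.card_pos.ne'
  simp only [finAvg, smul_eq_mul, Finset.mul_sum]
  exact Real.pow_arith_mean_le_arith_mean_pow J _ _ (fun _ _ => by positivity) (by simp [hc]) hu m

lemma finAvg_prod_eq_norm_sq {V : Type*} (F : Finset V) (w : V → ℂ) :
    finAvg (F ×ˢ F) (fun h => w h.1 * (starRingEnd ℂ) (w h.2)) = ((‖finAvg F w‖ ^ 2 : ℝ) : ℂ) := by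
  rw [Complex.ofReal_pow, ← Complex.mul_conj']
  simp only [finAvg, Complex.real_smul, map_mul, map_sum, Complex.conj_ofReal]
  rw [mul_mul_mul_comm, Finset.sum_mul_sum, ← Finset.sum_product', Finset.card_product]
  push_cast
  rw [mul_inv]

lemma integrable_finAvg {V X E : Type*} [MeasurableSpace X] {μ : Measure X} [NormedAddCommGroup E]
    [NormedSpace ℝ E] (J : Finset V) {w : V → X → E} (hw : ∀ n, Integrable (w n) μ) :
    Integrable (fun x => finAvg J (fun n => w n x)) μ :=
  (integrable_finsetSum J fun n _ => hw n).smul _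

lemma integral_finAvg {V X E : Type*} [MeasurableSpace X] {μ : Measure X} [NormedAddCommGroup E]
    [NormedSpace ℝ E] (J : Finset V) {w : V → X → E} (hw : ∀ n, Integrable (w n) μ) :
    ∫ x, finAvg J (fun n => w n x) ∂μ = finAvg J (fun n => ∫ x, w n x ∂μ) := by
  simp only [finAvg]
  rw [integral_smul, integral_finsetSum _ fun n _ => hw n]

end FinAvg

/-- A sequence of finite sets that is asymptotically invariant under every translation. -/
structure IsFolnerSeq {V : Type*} [AddCommGroup V] [DecidableEq V] (J : ℕ → Finset V) : Prop where
  eventually_nonempty : ∀ᶠ N in atTop, (J N).Nonempty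
  tendsto_symmDiff : ∀ h : V, Tendsto
    (fun N => (((J N).map (addRightEmbedding h) ∆ J N).card : ℝ) / (J N).card) atTop (𝓝 0)

section Folner

variable {V : Type*} [AddCommGroup V] [DecidableEq V]

lemma norm_finAvg_shift_sub_le {E : Type*} [NormedAddCommGroup E] [NormedSpace ℝ E]
    (J : Finset V) {u : V → E} {C : ℝ} (hu : ∀ n, ‖u n‖ ≤ C) (h : V) :
    ‖finAvg J (fun n => u (n + h)) - finAvg J u‖
      ≤ C * (((J.map (addRightEmbedding h) ∆ J).card : ℝ) / J.card) := by
  have h1 : ∑ n ∈ J, u (n + h) = ∑ n ∈ J.map (addRightEmbedding h), u n := by simp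
  rw [finAvg, finAvg, ← smul_sub, h1, ← Finset.sum_sdiff_sub_sum_sdiff, norm_smul, norm_inv,
    Real.norm_natCast, div_eq_inv_mul, mul_left_comm]
  refine mul_le_mul_of_nonneg_left ?_ (by positivity)
  refine (norm_sub_le _ _).trans ?_
  have h2 : ((J.map (addRightEmbedding h) ∆ J).card : ℝ)
      = (J.map (addRightEmbedding h) \ J).card + (J \ J.map (addRightEmbedding h)).card := by
    rw [symmDiff_def, Finset.sup_eq_union, Finset.card_union_of_disjoint]
    · push_cast; rfl
    · exact disjoint_sdiff_sdiff
  rw [h2, mul_add]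
  refine add_le_add ?_ ?_
  · simpa [mul_comm] using norm_sum_le_of_le (J.map (addRightEmbedding h) \ J) (fun n _ => hu n)
  · simpa [mul_comm] using norm_sum_le_of_le (J \ J.map (addRightEmbedding h)) (fun n _ => hu n)

lemma IsFolnerSeq.tendsto_shift {E : Type*} [NormedAddCommGroup E] [NormedSpace ℝ E]
    {J : ℕ → Finset V} (hJ : IsFolnerSeq J) {u : V → E} {C : ℝ} (hu : ∀ n, ‖u n‖ ≤ C) (h : V) :
    Tendsto (fun N => finAvg (J N) (fun n => u (n + h)) - finAvg (J N) u) atTop (𝓝 0) := by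
  refine squeeze_zero_norm (fun N => norm_finAvg_shift_sub_le (J N) hu h) ?_
  simpa using (hJ.tendsto_symmDiff h).const_mul C

lemma IsFolnerSeq.translate {J : ℕ → Finset V} (hJ : IsFolnerSeq J) (a : ℕ → V) :
    IsFolnerSeq (fun N => (J N).map (addRightEmbedding (a N))) where
  eventually_nonempty := by simpa using hJ.eventually_nonempty
  tendsto_symmDiff h := by
    refine (hJ.tendsto_symmDiff h).congr fun N => ?_
    have : ((J N).map (addRightEmbedding (a N))).map (addRightEmbedding h) =
        ((J N).map (addRightEmbedding h)).map (addRightEmbedding (a N)) := by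
      simp only [Finset.map_map]
      congr 1
      ext n
      simp [add_right_comm]
    rw [this, Finset.card_map]
    congr 2
    rw [symmDiff_def, symmDiff_def, ← Finset.map_sdiff, ← Finset.map_sdiff, Finset.sup_eq_union,
      Finset.sup_eq_union, ← Finset.map_union, Finset.card_map]

/-- The boxes `{0, …, N}^r` form a Følner sequence in `ℤ^r`. -/
lemma exists_isFolnerSeq (r : ℕ) : ∃ J : ℕ → Finset (Fin r → ℤ), IsFolnerSeq J := by
  refine ⟨fun N => Fintype.piFinset fun _ => Finset.Ico (0 : ℤ) (N + 1), ?_, fun h => ?_⟩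
  · exact Eventually.of_forall fun N => ⟨0, by simp⟩
  set J : ℕ → Finset (Fin r → ℤ) := fun N => Fintype.piFinset fun _ => Finset.Ico (0 : ℤ) (N + 1)
  have hcard : ∀ N, ((J N).card : ℝ) = ∏ _i : Fin r, ((N : ℝ) + 1) := fun N => by
    simp [J, Fintype.card_piFinset]
  have hpos : ∀ N, (0 : ℝ) < (J N).card := fun N => by
    rw [hcard]; positivity
  -- the overlap of a box with its translate is again a box
  have hinter : ∀ N : ℕ, (∀ i, |(h i : ℝ)| ≤ (N : ℝ) + 1) →
      ∏ i, (1 - |(h i : ℝ)| / ((N : ℝ) + 1)) ≤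
        (((J N).map (addRightEmbedding h) ∩ J N).card : ℝ) / (J N).card := by
    intro N hN
    have hsub : (Fintype.piFinset fun i => Finset.Ico (max 0 (h i)) (min (N + 1) (N + 1 + h i)))
        ⊆ (J N).map (addRightEmbedding h) ∩ J N := by
      intro n hn
      simp only [Fintype.mem_piFinset, Finset.mem_Ico, J, Finset.mem_inter, Finset.mem_map] at hn ⊢
      refine ⟨⟨n - h, fun i => ?_, by simp⟩, fun i => ?_⟩
      · have := hn i; simp only [Pi.sub_apply]; omega
      · have := hn i; omega
    have hle := Finset.card_le_card hsub
    rw [Fintype.card_piFinset] at hle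
    have hle' : ∏ i, ((N : ℝ) + 1 - |(h i : ℝ)|) ≤ (((J N).map (addRightEmbedding h) ∩ J N).card : ℝ) := by
      refine le_trans (le_of_eq ?_) (Nat.cast_le.2 hle)
      push_cast
      refine Finset.prod_congr rfl fun i _ => ?_
      have hi := hN i
      have hi' : |h i| ≤ N + 1 := by exact_mod_cast hi
      have : ((min ((N : ℤ) + 1) (N + 1 + h i) - max 0 (h i)).toNat : ℤ) = N + 1 - |h i| := by
        rcases abs_cases (h i) with ⟨h1, h2⟩ | ⟨h1, h2⟩ <;> omega
      rw [Int.card_Ico]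
      have := congrArg (Int.cast : ℤ → ℝ) this
      push_cast at this ⊢
      linarith
    rw [le_div_iff₀ (hpos N), hcard, ← Finset.prod_mul_distrib]
    refine le_trans (le_of_eq (Finset.prod_congr rfl fun i _ => ?_)) hle'
    field_simp
  have hlim : Tendsto (fun N : ℕ => 2 - 2 * ∏ i, (1 - |(h i : ℝ)| / ((N : ℝ) + 1))) atTop (𝓝 0) := by
    have h1 : ∀ i, Tendsto (fun N : ℕ => 1 - |(h i : ℝ)| / ((N : ℝ) + 1)) atTop (𝓝 1) := fun i => by
      simpa using (tendsto_const_nhds (x := (1 : ℝ))).sub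
        ((tendsto_one_div_add_atTop_nhds_zero_nat (𝕜 := ℝ)).const_mul |(h i : ℝ)|
          |>.congr fun N => by ring)
    have h2 := tendsto_finsetProd Finset.univ fun i _ => h1 i
    simpa using (tendsto_const_nhds (x := (2 : ℝ))).sub (h2.const_mul 2)
  refine squeeze_zero' (Eventually.of_forall fun N => by positivity) ?_ hlim
  have hev : ∀ᶠ N : ℕ in atTop, ∀ i, |(h i : ℝ)| ≤ (N : ℝ) + 1 := by
    rw [eventually_all]
    intro i
    filter_upwards [eventually_ge_atTop (h i).natAbs] with N hN
    have : |h i| ≤ N := by rw [Int.abs_eq_natAbs]; exact_mod_cast hN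
    have : |(h i : ℝ)| ≤ N := by exact_mod_cast this
    linarith
  filter_upwards [hev] with N hN
  have h1 := hinter N hN
  have h2 : (((J N).map (addRightEmbedding h) ∆ J N).card : ℝ)
      = 2 * (J N).card - 2 * ((J N).map (addRightEmbedding h) ∩ J N).card := by
    have e1 := Finset.card_sdiff_add_card_inter ((J N).map (addRightEmbedding h)) (J N)
    have e2 := Finset.card_sdiff_add_card_inter (J N) ((J N).map (addRightEmbedding h))
    rw [Finset.card_map] at e1
    rw [Finset.inter_comm] at e2
    rw [symmDiff_def, Finset.sup_eq_union, Finset.card_union_of_disjoint disjoint_sdiff_sdiff]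
    have e1' : (((J N).map (addRightEmbedding h) \ J N).card : ℝ) + ((J N).map (addRightEmbedding h) ∩ J N).card
      = (J N).card := by exact_mod_cast e1
    have e2' : ((J N \ (J N).map (addRightEmbedding h)).card : ℝ) + ((J N).map (addRightEmbedding h) ∩ J N).card
      = (J N).card := by exact_mod_cast e2
    push_cast
    linarith
  rw [h2, sub_div, mul_div_assoc, div_self (hpos N).ne', mul_div_assoc]
  linarith

/-- Scalar van der Corput inequality, with an explicit error term for the failure of
invariance of `J` under the translations in `F`. -/
lemma norm_finAvg_sq_le_vanDerCorput (J F : Finset V) (hF : F.Nonempty) {u : V → ℂ}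
    (hu : ∀ n, ‖u n‖ ≤ 1) :
    ‖finAvg J u‖ ^ 2 ≤ finAvg J (fun n => finAvg (F ×ˢ F)
        (fun h => (u (n + h.1) * (starRingEnd ℂ) (u (n + h.2))).re))
      + 2 * finAvg F (fun h => ((J.map (addRightEmbedding h) ∆ J).card : ℝ) / J.card) := by
  set e := finAvg F (fun h => ((J.map (addRightEmbedding h) ∆ J).card : ℝ) / J.card)
  set b := finAvg J (fun n => finAvg F (fun h => u (n + h)))
  have hab : ‖b - finAvg J u‖ ≤ e := by
    have h1 : b - finAvg J u = finAvg F (fun h => finAvg J (fun n => u (n + h)) - finAvg J u) := by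
      rw [finAvg_sub, finAvg_const hF, ← finAvg_comm]
    rw [h1, finAvg, norm_smul, norm_inv, Real.norm_natCast]
    refine mul_le_mul_of_nonneg_left ?_ (by positivity)
    refine norm_sum_le_of_le _ fun h _ => ?_
    simpa using norm_finAvg_shift_sub_le J hu h
  have ha : ‖finAvg J u‖ ≤ 1 := norm_finAvg_le zero_le_one fun n _ => hu n
  have hb : ‖b‖ ≤ 1 := norm_finAvg_le zero_le_one fun n _ =>
    norm_finAvg_le zero_le_one fun h _ => hu _
  have hb2 : ‖b‖ ^ 2 ≤ finAvg J (fun n => finAvg (F ×ˢ F)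
        (fun h => (u (n + h.1) * (starRingEnd ℂ) (u (n + h.2))).re)) := by
    refine (norm_finAvg_sq_le _ _).trans (finAvg_mono fun n _ => le_of_eq ?_)
    have h1 := (finAvg_prod_eq_norm_sq F (fun h => u (n + h))).symm
    have h2 := congrArg Complex.re h1
    rw [Complex.ofReal_re] at h2
    rw [h2]
    exact map_finAvg Complex.reLm _ _
  have h3 : ‖finAvg J u‖ ≤ ‖b‖ + e := by
    have := norm_sub_norm_le (finAvg J u) b
    rw [norm_sub_rev] at this
    linarith
  have he : 0 ≤ e := (norm_nonneg _).trans hab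
  nlinarith [norm_nonneg (finAvg J u), norm_nonneg b]

lemma IsFolnerSeq.tendsto_error {J : ℕ → Finset V} (hJ : IsFolnerSeq J) (F : Finset V) :
    Tendsto (fun N => finAvg F
      (fun h => (((J N).map (addRightEmbedding h) ∆ J N).card : ℝ) / (J N).card)) atTop (𝓝 0) := by
  have := (tendsto_finsetSum F fun h _ => hJ.tendsto_symmDiff h).const_mul ((F.card : ℝ)⁻¹)
  simpa [finAvg] using this

/-- Mean ergodic theorem: for an isometric action of an abelian group on a Hilbert
space, the Følner averages of a vector orthogonal to the invariant vectors tend to zero. -/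
lemma tendsto_finAvg_of_orthogonal_invariants {H : Type*} [NormedAddCommGroup H]
    [InnerProductSpace ℂ H] [CompleteSpace H] [NormedSpace ℝ H] [IsScalarTower ℝ ℂ H]
    (U : V → H →ₗᵢ[ℂ] H) (hU : ∀ a b v, U (a + b) v = U a (U b v))
    {J : ℕ → Finset V} (hJ : IsFolnerSeq J) {x : H}
    (hx : ∀ w, (∀ n, U n w = w) → inner ℂ w x = 0) :
    Tendsto (fun N => finAvg (J N) (fun n => U n x)) atTop (𝓝 0) := by
  set S : Submodule ℂ H := Submodule.span ℂ {y | ∃ h w, y = U h w - w}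
  have hinv : ∀ y ∈ Sᗮ, ∀ n, U n y = y := by
    intro y hy n
    have h0 : inner ℂ (U n y - y) y = 0 :=
      (Submodule.mem_orthogonal S y).1 hy _ (Submodule.subset_span ⟨n, y, rfl⟩)
    rw [← sub_eq_zero, ← norm_eq_zero, ← sq_eq_zero_iff, @norm_sub_sq ℂ, (U n).norm_map]
    rw [inner_sub_left, sub_eq_zero] at h0
    rw [h0, inner_self_eq_norm_sq_to_K]
    norm_cast
    ring
  have hxS : x ∈ S.topologicalClosure := by
    rw [← Submodule.orthogonal_orthogonal_eq_closure, Submodule.mem_orthogonal]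
    exact fun w hw => hx w (hinv w hw)
  have hS : ∀ s ∈ S, Tendsto (fun N => finAvg (J N) (fun n => U n s)) atTop (𝓝 0) := by
    intro s hs
    induction hs using Submodule.span_induction with
    | mem y hy =>
      obtain ⟨h, w, rfl⟩ := hy
      have := hJ.tendsto_shift (u := fun n => U n w) (C := ‖w‖) (fun n => by simp) h
      refine this.congr fun N => ?_
      rw [← finAvg_sub]
      simp [hU]
    | zero => simp [finAvg]
    | add y z _ _ hy hz =>
      have := hy.add hz
      simp only [← finAvg_add, add_zero] at this
      simpa using this
    | smul c y _ hy =>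
      have := hy.const_smul c
      rw [smul_zero] at this
      refine this.congr fun N => ?_
      simp [finAvg, Finset.smul_sum, smul_comm c]
  rw [Metric.tendsto_nhds]
  intro ε hε
  obtain ⟨s, hs, hsx⟩ := Metric.mem_closure_iff.1 hxS (ε / 2) (by positivity)
  filter_upwards [(Metric.tendsto_nhds.1 (hS s hs)) (ε / 2) (by positivity)] with N hN
  rw [dist_zero_right] at hN ⊢
  have h1 : finAvg (J N) (fun n => U n x)
      = finAvg (J N) (fun n => U n (x - s)) + finAvg (J N) (fun n => U n s) := by
    rw [← finAvg_add]; simp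
  have h2 : ‖finAvg (J N) (fun n => U n (x - s))‖ ≤ dist x s :=
    norm_finAvg_le dist_nonneg fun n _ => by rw [(U n).norm_map, dist_eq_norm]
  rw [h1]
  calc _ ≤ _ := norm_add_le _ _
    _ < ε := by linarith

end Folner

/-! ### Isotropy factors and the mean ergodic theorem -/

/-- Measurable functions bounded by one in absolute value, everywhere and not just almost
everywhere. -/
structure IsUnitBounded {X : Type*} [MeasurableSpace X] (f : X → ℂ) : Prop where
  measurable : Measurable f
  norm_le : ∀ x, ‖f x‖ ≤ 1

namespace IsUnitBounded

variable {X Y : Type*} [MeasurableSpace X] [MeasurableSpace Y] {f g : X → ℂ}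

lemma mul (hf : IsUnitBounded f) (hg : IsUnitBounded g) : IsUnitBounded (fun x => f x * g x) :=
  ⟨hf.measurable.mul hg.measurable, fun x => by
    rw [norm_mul]; exact mul_le_one₀ (hf.norm_le x) (norm_nonneg _) (hg.norm_le x)⟩

lemma conj (hf : IsUnitBounded f) : IsUnitBounded (fun x => (starRingEnd ℂ) (f x)) :=
  ⟨Complex.continuous_conj.measurable.comp hf.measurable, fun x => by
    rw [RCLike.norm_conj]; exact hf.norm_le x⟩

lemma comp (hf : IsUnitBounded f) {φ : Y → X} (hφ : Measurable φ) :
    IsUnitBounded (fun y => f (φ y)) :=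
  ⟨hf.measurable.comp hφ, fun y => hf.norm_le (φ y)⟩

lemma one : IsUnitBounded (fun _ : X => (1 : ℂ)) := ⟨measurable_const, by simp⟩

lemma list_prod {ι : Type*} (K : List ι) {F : ι → X → ℂ} (h : ∀ i, IsUnitBounded (F i)) :
    IsUnitBounded (fun x => (K.map fun i => F i x).prod) := by
  induction K with
  | nil => simpa using one
  | cons i K ih => simpa using (h i).mul ih

lemma finAvg {V : Type*} (J : Finset V) {F : V → X → ℂ} (h : ∀ n, IsUnitBounded (F n)) :
    IsUnitBounded (fun x => finAvg J (fun n => F n x)) :=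
  ⟨(Finset.measurable_sum J fun n _ => (h n).measurable).const_smul _,
    fun x => norm_finAvg_le zero_le_one fun n _ => (h n).norm_le x⟩

lemma memLp (hf : IsUnitBounded f) (μ : Measure X) [IsFiniteMeasure μ] (p : ENNReal) :
    MemLp f p μ :=
  MemLp.of_bound hf.measurable.aestronglyMeasurable 1 (Eventually.of_forall hf.norm_le)

lemma integrable (hf : IsUnitBounded f) (μ : Measure X) [IsFiniteMeasure μ] : Integrable f μ :=
  memLp_one_iff_integrable.1 (hf.memLp μ 1)

lemma integrable_norm_sq (hf : IsUnitBounded f) (μ : Measure X) [IsFiniteMeasure μ] :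
    Integrable (fun x => ‖f x‖ ^ 2) μ :=
  (hf.memLp μ 2).integrable_norm_pow two_ne_zero

lemma indicator {s : Set X} (hs : MeasurableSet s) :
    IsUnitBounded (s.indicator fun _ => (1 : ℂ)) :=
  ⟨measurable_const.indicator hs, fun x => by by_cases h : x ∈ s <;> simp [h]⟩

end IsUnitBounded

section Isotropy

variable {r d : ℕ} {X : Type u} [m₀ : MeasurableSpace X] {μ : Measure X}
  {T : ZGroup r d → X → X} {Γ : AddSubgroup (ZGroup r d)}

lemma isotropyFactor_le : isotropyFactor μ T Γ ≤ m₀ := fun _ hA => hA.1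

lemma comp_ae_eq_of_measurable_isotropyFactor {f : X → ℂ}
    (hf : Measurable[isotropyFactor μ T Γ] f) {γ : ZGroup r d} (hγ : γ ∈ Γ) :
    (fun x => f (T γ x)) =ᵐ[μ] f :=
  EventuallyEq.of_forall_separating_preimage MeasurableSet fun _ hU => (hf hU).2 γ hγ

lemma measurable_isotropyFactor_of_comp_ae_eq {f : X → ℂ} (hf : Measurable f)
    (h : ∀ γ ∈ Γ, (fun x => f (T γ x)) =ᵐ[μ] f) : Measurable[isotropyFactor μ T Γ] f :=
  fun U hU => ⟨hf hU, fun γ hγ => by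
    filter_upwards [h γ hγ] with x hx
    exact congrArg (· ∈ U) hx⟩

variable (hT : IsPreservingAction μ T) (ρ : (Fin r → ℤ) →+ ZGroup r d)

/-- The Koopman isometries on `L²(μ)` of the `ℤ^r`-action obtained by restricting `T` along `ρ`. -/
noncomputable def koopman (n : Fin r → ℤ) : Lp ℂ 2 μ →ₗᵢ[ℂ] Lp ℂ 2 μ :=
  Lp.compMeasurePreservingₗᵢ ℂ (T (ρ n)) (hT.measurePreserving (ρ n))

lemma koopman_toLp (n : Fin r → ℤ) {f : X → ℂ} (hf : MemLp f 2 μ) :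
    koopman hT ρ n (hf.toLp f)
      = (hf.comp_measurePreserving (hT.measurePreserving (ρ n))).toLp (f ∘ T (ρ n)) :=
  Lp.toLp_compMeasurePreserving hf _

lemma koopman_coeFn (n : Fin r → ℤ) (v : Lp ℂ 2 μ) :
    koopman hT ρ n v =ᵐ[μ] fun x => v (T (ρ n) x) :=
  Lp.coeFn_compMeasurePreserving v _

lemma koopman_add (a b : Fin r → ℤ) (v : Lp ℂ 2 μ) :
    koopman hT ρ (a + b) v = koopman hT ρ a (koopman hT ρ b v) := by
  refine Lp.ext ?_
  have h1 := (hT.measurePreserving (ρ a)).quasiMeasurePreserving.ae_eq (koopman_coeFn hT ρ b v)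
  filter_upwards [koopman_coeFn hT ρ (a + b) v, koopman_coeFn hT ρ a (koopman hT ρ b v), h1]
    with x hx1 hx2 hx3
  rw [hx1, hx2]
  simp only [Function.comp] at hx3
  rw [hx3, map_add, add_comm, hT.map_add]

/-- An `L²` vector is invariant under the Koopman isometries exactly when it is measurable with
respect to the isotropy factor. -/
lemma koopman_invariant_iff (v : Lp ℂ 2 μ) :
    (∀ n, koopman hT ρ n v = v) ↔ v ∈ lpMeas ℂ ℂ (isotropyFactor μ T ρ.range) 2 μ := by
  rw [mem_lpMeas_iff_aestronglyMeasurable]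
  constructor
  · intro h
    refine ⟨v, Measurable.stronglyMeasurable ?_, EventuallyEq.rfl⟩
    refine measurable_isotropyFactor_of_comp_ae_eq (Lp.stronglyMeasurable v).measurable ?_
    rintro _ ⟨n, rfl⟩
    refine (koopman_coeFn hT ρ n v).symm.trans ?_
    rw [h n]
  · rintro ⟨f, hf, hvf⟩ n
    refine Lp.ext ((koopman_coeFn hT ρ n v).trans ?_)
    have h1 := (hT.measurePreserving (ρ n)).quasiMeasurePreserving.ae_eq hvf
    exact h1.trans ((comp_ae_eq_of_measurable_isotropyFactor hf.measurable ⟨n, rfl⟩).trans hvf.symm)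

lemma tendsto_finAvg_koopman [IsFiniteMeasure μ] {J : ℕ → Finset (Fin r → ℤ)} (hJ : IsFolnerSeq J) (v : Lp ℂ 2 μ) :
    Tendsto (fun N => finAvg (J N) (fun n => koopman hT ρ n v)) atTop
      (𝓝 (condExpL2 ℂ ℂ (isotropyFactor_le (μ := μ) (T := T) (Γ := ρ.range)) v : Lp ℂ 2 μ)) := by
  have hle := isotropyFactor_le (μ := μ) (T := T) (Γ := ρ.range)
  set p : Lp ℂ 2 μ := (condExpL2 ℂ ℂ hle v : Lp ℂ 2 μ) with hp
  have hpinv : ∀ n, koopman hT ρ n p = p := (koopman_invariant_iff hT ρ p).2 (Subtype.mem _)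
  have h0 : Tendsto (fun N => finAvg (J N) (fun n => koopman hT ρ n (v - p))) atTop (𝓝 0) := by
    refine tendsto_finAvg_of_orthogonal_invariants _ (koopman_add hT ρ) hJ fun w hw => ?_
    have hw' := (koopman_invariant_iff hT ρ w).1 hw
    have h1 : (condExpL2 ℂ ℂ hle w : Lp ℂ 2 μ) = w := by
      have : Fact (isotropyFactor μ T ρ.range ≤ m₀) := ⟨hle⟩
      exact Submodule.starProjection_eq_self_iff.2 hw'
    rw [inner_sub_right, sub_eq_zero, hp, ← inner_condExpL2_left_eq_right, h1]
  refine (h0.add (tendsto_const_nhds (x := p))).congr' ?_ |>.trans (by rw [zero_add])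
  filter_upwards [hJ.eventually_nonempty] with N hN
  have : (fun n => koopman hT ρ n (v - p)) = fun n => koopman hT ρ n v - p := by
    ext1 n; rw [map_sub, hpinv]
  rw [this, finAvg_sub, finAvg_const hN, sub_add_cancel]

lemma inner_toLp {f g : X → ℂ} (hf : MemLp f 2 μ) (hg : MemLp g 2 μ) :
    inner ℂ (hf.toLp f) (hg.toLp g) = ∫ x, (starRingEnd ℂ) (f x) * g x ∂μ := by
  rw [L2.inner_def]
  refine integral_congr_ae ?_
  filter_upwards [hf.coeFn_toLp, hg.coeFn_toLp] with x h1 h2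
  rw [h1, h2]
  simp [mul_comm]

lemma inner_toLp_condExpL2 [IsFiniteMeasure μ] {f g : X → ℂ} (hf : MemLp f 2 μ) (hg : MemLp g 2 μ)
    {m : MeasurableSpace X} (hm : m ≤ m₀) :
    inner ℂ (hf.toLp f) (condExpL2 ℂ ℂ hm (hg.toLp g) : Lp ℂ 2 μ)
      = ∫ x, (starRingEnd ℂ) (f x) * (μ[g | m]) x ∂μ := by
  rw [L2.inner_def]
  refine integral_congr_ae ?_
  filter_upwards [hf.coeFn_toLp, hg.condExpL2_ae_eq_condExp (𝕜 := ℂ) hm] with x h1 h2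
  rw [h1, h2]
  simp [mul_comm]

/-- Weak form of the mean ergodic theorem for bounded functions. -/
lemma tendsto_finAvg_integral_mul [IsFiniteMeasure μ]
    (hT : IsPreservingAction μ T) (ρ : (Fin r → ℤ) →+ ZGroup r d) {J : ℕ → Finset (Fin r → ℤ)} (hJ : IsFolnerSeq J)
    {f g : X → ℂ} (hf : IsUnitBounded f) (hg : IsUnitBounded g) :
    Tendsto (fun N => finAvg (J N) (fun n => ∫ x, f x * g (T (ρ n) x) ∂μ)) atTop
      (𝓝 (∫ x, f x * (μ[g | isotropyFactor μ T ρ.range]) x ∂μ)) := by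
  have h := (tendsto_finAvg_koopman hT ρ hJ ((hg.memLp μ 2).toLp g))
  have h' := (tendsto_const_nhds (x := (hf.conj.memLp μ 2).toLp _)).inner (𝕜 := ℂ) h
  rw [inner_toLp_condExpL2] at h'
  simp only [Complex.conj_conj] at h'
  refine h'.congr fun N => ?_
  have h1 := map_finAvg ((innerSL ℂ ((hf.conj.memLp μ 2).toLp _)).toLinearMap.restrictScalars ℝ)
    (J N) (fun n => koopman hT ρ n ((hg.memLp μ 2).toLp g))
  simp only [LinearMap.coe_restrictScalars, ContinuousLinearMap.coe_coe, innerSL_apply_apply] at h1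
  rw [h1]
  congr 1
  ext1 n
  rw [koopman_toLp, inner_toLp]
  simp

/-- Norm form of the mean ergodic theorem for bounded functions. -/
lemma tendsto_integral_norm_finAvg_sq [IsFiniteMeasure μ]
    (hT : IsPreservingAction μ T) (ρ : (Fin r → ℤ) →+ ZGroup r d) {J : ℕ → Finset (Fin r → ℤ)} (hJ : IsFolnerSeq J)
    {f : X → ℂ} (hf : IsUnitBounded f) :
    Tendsto (fun N => ∫ x, ‖finAvg (J N) (fun n => f (T (ρ n) x))‖ ^ 2 ∂μ) atTop
      (𝓝 (∫ x, (starRingEnd ℂ) (f x) * (μ[f | isotropyFactor μ T ρ.range]) x ∂μ).re) := by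
  have hle := isotropyFactor_le (μ := μ) (T := T) (Γ := ρ.range)
  set v := (hf.memLp μ 2).toLp f
  have h := (tendsto_finAvg_koopman hT ρ hJ v).norm.pow 2
  have hnorm : ‖(condExpL2 ℂ ℂ hle v : Lp ℂ 2 μ)‖ ^ 2
      = (∫ x, (starRingEnd ℂ) (f x) * (μ[f | isotropyFactor μ T ρ.range]) x ∂μ).re := by
    have : Fact (isotropyFactor μ T ρ.range ≤ m₀) := ⟨hle⟩
    have h1 : (condExpL2 ℂ ℂ hle (condExpL2 ℂ ℂ hle v : Lp ℂ 2 μ) : Lp ℂ 2 μ)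
        = (condExpL2 ℂ ℂ hle v : Lp ℂ 2 μ) :=
      Submodule.starProjection_eq_self_iff.2 (Subtype.mem _)
    have h2 := inner_condExpL2_left_eq_right (𝕜 := ℂ) hle (f := v)
      (g := (condExpL2 ℂ ℂ hle v : Lp ℂ 2 μ))
    rw [h1] at h2
    rw [← inner_toLp_condExpL2 (hf.memLp μ 2) (hf.memLp μ 2) hle, ← h2]
    exact norm_sq_eq_re_inner (𝕜 := ℂ) (E := Lp ℂ 2 μ) _
  rw [hnorm] at h
  refine h.congr fun N => ?_
  have hb : IsUnitBounded (fun x => finAvg (J N) (fun n => f (T (ρ n) x))) :=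
    IsUnitBounded.finAvg _ fun n => hf.comp (hT.measurePreserving _).measurable
  have h2 : finAvg (J N) (fun n => koopman hT ρ n v) = (hb.memLp μ 2).toLp _ := by
    refine Lp.ext (EventuallyEq.trans ?_ (MemLp.coeFn_toLp _).symm)
    have h3 : ∀ᵐ x ∂μ, ∀ n, koopman hT ρ n v x = f (T (ρ n) x) := by
      rw [ae_all_iff]
      intro n
      simp only [v, koopman_toLp]
      exact MemLp.coeFn_toLp _
    have h4 := Lp.coeFn_smul ((J N).card : ℝ)⁻¹ (∑ n ∈ J N, koopman hT ρ n v)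
    have h5 := Lp.coeFn_finsetSum (J N) (fun n => koopman hT ρ n v)
    filter_upwards [h3, h4, h5] with x hx3 hx4 hx5
    simp only [finAvg]
    rw [hx4, Pi.smul_apply, hx5, Finset.sum_apply]
    simp [hx3]
  rw [h2, norm_sq_eq_re_inner (𝕜 := ℂ) (E := Lp ℂ 2 μ), inner_toLp, RCLike.re_eq_complex_re]
  have h7 : ∀ x, (starRingEnd ℂ) (finAvg (J N) (fun n => f (T (ρ n) x)))
      * finAvg (J N) (fun n => f (T (ρ n) x)) = ((‖finAvg (J N) (fun n => f (T (ρ n) x))‖ ^ 2 : ℝ) : ℂ) :=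
    fun x => by rw [mul_comm, Complex.mul_conj']; norm_cast
  simp only [h7]
  rw [integral_complex_ofReal, Complex.ofReal_re]

end Isotropy

/-! ### Relatively independent squares -/

section RelSquare

open ProbabilityTheory

variable {X : Type u} {m : MeasurableSpace X} [m₀ : MeasurableSpace X] [StandardBorelSpace X]
  (μ : Measure X) [IsProbabilityMeasure μ] (hm : m ≤ m₀)

/-- The relatively independent self-joining of `μ` over a sub-σ-algebra `m`: the law of a pair
whose first point has law `μ` and whose second point is drawn from the conditional law of `μ`
given `m` at the first point. -/
noncomputable def relSquare : Measure (X × X) :=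
  μ ⊗ₘ (condExpKernel μ m).comap id (measurable_id'' hm)

instance : IsProbabilityMeasure (relSquare μ hm) := by
  unfold relSquare; infer_instance

lemma integral_relSquare_mul {f g : X → ℂ} (hf : IsUnitBounded f) (hg : IsUnitBounded g) :
    ∫ z, f z.1 * g z.2 ∂(relSquare μ hm) = ∫ x, f x * (μ[g | m]) x ∂μ := by
  have hfg : IsUnitBounded (fun z : X × X => f z.1 * g z.2) :=
    (hf.comp measurable_fst).mul (hg.comp measurable_snd)
  have h := hfg.integrable (relSquare μ hm)
  unfold relSquare at h ⊢
  rw [Measure.integral_compProd h]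
  refine integral_congr_ae ?_
  filter_upwards [condExp_ae_eq_integral_condExpKernel hm (hg.integrable μ)] with x hx
  rw [hx, integral_const_mul]
  rfl

end RelSquare

/-- Probability measures on a product are determined by the integrals of products of indicators. -/
lemma measure_prod_ext_of_integral {X Y : Type*} [MeasurableSpace X] [MeasurableSpace Y]
    {μ ν : Measure (X × Y)} [IsProbabilityMeasure μ] [IsProbabilityMeasure ν]
    (h : ∀ (f : X → ℂ) (g : Y → ℂ), IsUnitBounded f → IsUnitBounded g →
      ∫ z, f z.1 * g z.2 ∂μ = ∫ z, f z.1 * g z.2 ∂ν) : μ = ν := by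
  refine Measure.ext_prod fun {s t} hs ht => ?_
  have key : ∀ (κ : Measure (X × Y)) [IsProbabilityMeasure κ],
      ∫ z, s.indicator (fun _ => (1 : ℂ)) z.1 * t.indicator (fun _ => (1 : ℂ)) z.2 ∂κ
        = (κ.real (s ×ˢ t) : ℂ) := by
    intro κ _
    have : (fun z : X × Y => s.indicator (fun _ => (1 : ℂ)) z.1 * t.indicator (fun _ => (1 : ℂ)) z.2)
        = (s ×ˢ t).indicator (fun _ => (1 : ℂ)) := by
      ext1 z
      by_cases h1 : z.1 ∈ s <;> by_cases h2 : z.2 ∈ t <;> simp [h1, h2, Set.indicator]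
    rw [this, integral_indicator_const _ (hs.prod ht)]
    simp
  have := h _ _ (IsUnitBounded.indicator hs) (IsUnitBounded.indicator ht)
  rw [key, key] at this
  rw [← ENNReal.toReal_eq_toReal_iff' (measure_ne_top _ _) (measure_ne_top _ _)]
  exact_mod_cast this

lemma integral_comp_measurePreserving {X Y E : Type*} [MeasurableSpace X] [MeasurableSpace Y]
    {μ : Measure X} {ν : Measure Y} {φ : X → Y} (hφ : MeasurePreserving φ μ ν)
    [NormedAddCommGroup E] [NormedSpace ℝ E] {f : Y → E} (hf : AEStronglyMeasurable f ν) :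
    ∫ x, f (φ x) ∂μ = ∫ y, f y ∂ν := by
  obtain rfl := hφ.map_eq
  exact (integral_map hφ.measurable.aemeasurable hf).symm

/-! ### The directions of the cube construction -/

section Directions

variable {r d : ℕ}

lemma blockEmb_apply (i j : Fin d) (n : Fin r → ℤ) : blockEmb i n j = if j = i then n else 0 := by
  simp [blockEmb, Pi.single_apply]

variable [NeZero d]

/-- The subactions of `ℤ^r` in `ℤ^{rd}` along which cubes are formed: `α_0`, and the
differences `α_0 - α_k` for `k ≠ 0`. -/
def direction (k : Fin d) : (Fin r → ℤ) →+ ZGroup r d :=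
  if k = 0 then blockEmb 0 else blockEmb 0 - blockEmb k

/-- The coordinates of an element of `ℤ^{rd}` with respect to the splitting of `ℤ^{rd}` as the
direct sum of the images of the maps `direction k`. -/
def directionCoeff (k : Fin d) : ZGroup r d →+ (Fin r → ℤ) :=
  if k = 0 then ∑ i, Pi.evalAddMonoidHom (fun _ : Fin d => Fin r → ℤ) i
  else -Pi.evalAddMonoidHom (fun _ : Fin d => Fin r → ℤ) k

/-- The projection of `ℤ^{rd}` that kills `direction k` and fixes all other directions. -/
def dropDirection (k : Fin d) : ZGroup r d →+ ZGroup r d :=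
  AddMonoidHom.id _ - (direction k).comp (directionCoeff k)

lemma directionCoeff_direction (j k : Fin d) (n : Fin r → ℤ) :
    directionCoeff j (direction k n) = if j = k then n else 0 := by
  unfold directionCoeff direction
  by_cases hj : j = 0 <;> by_cases hk : k = 0
  · subst hj hk; simp [AddMonoidHom.finsetSum_apply, blockEmb_apply]
  · subst hj
    simp [hk, Ne.symm hk, AddMonoidHom.finsetSum_apply, blockEmb_apply, Finset.sum_sub_distrib]
  · subst hk; simp [hj, blockEmb_apply]
  · simp [hj, hk, blockEmb_apply]

lemma dropDirection_apply (k : Fin d) (g : ZGroup r d) :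
    dropDirection k g = g - direction k (directionCoeff k g) := rfl

lemma dropDirection_direction_self (k : Fin d) (n : Fin r → ℤ) :
    dropDirection k (direction k n) = 0 := by
  simp [dropDirection_apply, directionCoeff_direction]

lemma dropDirection_direction_of_ne {j k : Fin d} (h : k ≠ j) (n : Fin r → ℤ) :
    dropDirection k (direction j n) = direction j n := by
  simp [dropDirection_apply, directionCoeff_direction, h]

end Directions

/-! ### Systems and their cubes -/

/-- A probability-preserving `ℤ^{rd}`-system on a standard Borel space, as a bundled object. -/
structure MPSystem (r d : ℕ) where
  carrier : Type u
  [measurableSpace : MeasurableSpace carrier]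
  [standardBorel : StandardBorelSpace carrier]
  μ : Measure carrier
  [isProbability : IsProbabilityMeasure μ]
  T : ZGroup r d → carrier → carrier
  isAction : IsPreservingAction μ T

attribute [instance] MPSystem.measurableSpace MPSystem.standardBorel MPSystem.isProbability

namespace MPSystem

variable {r d : ℕ}

lemma measurable_T (A : MPSystem.{u} r d) (g : ZGroup r d) : Measurable (A.T g) :=
  (A.isAction.measurePreserving g).measurable

/-- Extension maps between bundled systems. -/
abbrev IsExtension (B A : MPSystem.{u} r d) (ψ : B.carrier → A.carrier) : Prop :=
  IsExtensionMap B.μ B.T A.μ A.T ψ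

lemma IsExtension.comp {A B C : MPSystem.{u} r d} {ψ : B.carrier → A.carrier}
    {φ : C.carrier → B.carrier} (hψ : IsExtension B A ψ) (hφ : IsExtension C B φ) :
    IsExtension C A (ψ ∘ φ) :=
  ⟨hψ.measurePreserving.comp hφ.measurePreserving, fun g y => by
    simp only [Function.comp, hφ.intertwines, hψ.intertwines]⟩

variable [NeZero d]

/-- The σ-algebra of sets that are invariant, up to null sets, along `direction k`. -/
abbrev isotropy (A : MPSystem.{u} r d) (k : Fin d) : MeasurableSpace A.carrier :=
  isotropyFactor A.μ A.T (direction (r := r) k).range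

lemma isotropy_le (A : MPSystem.{u} r d) (k : Fin d) : A.isotropy k ≤ A.measurableSpace :=
  isotropyFactor_le

/-- The relatively independent square of the measure over the isotropy factor in direction `k`. -/
noncomputable abbrev cubeMeasure (A : MPSystem.{u} r d) (k : Fin d) :
    Measure (A.carrier × A.carrier) :=
  relSquare A.μ (A.isotropy_le k)

lemma tendsto_cubeMeasure (A : MPSystem.{u} r d) (k : Fin d) {J : ℕ → Finset (Fin r → ℤ)}
    (hJ : IsFolnerSeq J) {f g : A.carrier → ℂ} (hf : IsUnitBounded f) (hg : IsUnitBounded g) :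
    Tendsto (fun N => finAvg (J N) (fun n => ∫ x, f x * g (A.T (direction k n) x) ∂A.μ)) atTop
      (𝓝 (∫ z, f z.1 * g z.2 ∂A.cubeMeasure k)) := by
  rw [integral_relSquare_mul _ _ hf hg]
  exact tendsto_finAvg_integral_mul A.isAction (direction k) hJ hf hg

/-- The side transformations of the cube: the second coordinate does not see `direction k`. -/
def cubeT (A : MPSystem.{u} r d) (k : Fin d) (g : ZGroup r d) (z : A.carrier × A.carrier) :
    A.carrier × A.carrier :=
  (A.T g z.1, A.T (dropDirection k g) z.2)

lemma measurable_cubeT (A : MPSystem.{u} r d) (k : Fin d) (g : ZGroup r d) :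
    Measurable (A.cubeT k g) :=
  ((A.measurable_T _).comp measurable_fst).prodMk ((A.measurable_T _).comp measurable_snd)

lemma measurePreserving_cubeT (A : MPSystem.{u} r d) (k : Fin d) (g : ZGroup r d) :
    MeasurePreserving (A.cubeT k g) (A.cubeMeasure k) (A.cubeMeasure k) := by
  refine ⟨A.measurable_cubeT k g, ?_⟩
  have := Measure.isProbabilityMeasure_map (μ := A.cubeMeasure k)
    (A.measurable_cubeT k g).aemeasurable
  refine measure_prod_ext_of_integral fun f h hf hh => ?_
  have hfh : IsUnitBounded (fun z : A.carrier × A.carrier => f z.1 * h z.2) :=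
    (hf.comp measurable_fst).mul (hh.comp measurable_snd)
  rw [integral_map (A.measurable_cubeT k g).aemeasurable hfh.measurable.aestronglyMeasurable]
  obtain ⟨J, hJ⟩ := exists_isFolnerSeq r
  have h1 := A.tendsto_cubeMeasure k hJ (hf.comp (A.measurable_T g))
    (hh.comp (A.measurable_T (dropDirection k g)))
  have h2 := A.tendsto_cubeMeasure k hJ hf hh
  set u : (Fin r → ℤ) → ℂ := fun n => ∫ x, f x * h (A.T (direction k n) x) ∂A.μ
  have hu : ∀ n, ‖u n‖ ≤ 1 := fun n => by
    refine (norm_integral_le_of_norm_le_const (Eventually.of_forall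
      (hf.mul (hh.comp (A.measurable_T (direction k n)))).norm_le)).trans ?_
    simp
  -- `T^{drop g}` differs from `T^g` by a translation along `direction k`, which Følner averages ignore
  have h3 : ∀ n, ∫ x, f (A.T g x) * h (A.T (dropDirection k g) (A.T (direction k n) x)) ∂A.μ
      = u (n + -directionCoeff k g) := by
    intro n
    refine Eq.trans ?_ (integral_comp_measurePreserving (A.isAction.measurePreserving g)
      (f := fun x => f x * h (A.T (direction k (n + -directionCoeff k g)) x)) (hf.measurable.mul (hh.measurable.comp (A.measurable_T _))).aestronglyMeasurable)
    refine integral_congr_ae (Eventually.of_forall fun x => ?_)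
    simp only
    rw [← A.isAction.map_add, ← A.isAction.map_add, dropDirection_apply, map_add, map_neg]
    congr 3
    abel
  simp only [h3] at h1
  have h4 := (hJ.tendsto_shift hu (-directionCoeff k g)).add h2
  simp only [sub_add_cancel, zero_add] at h4
  exact tendsto_nhds_unique h1 h4

/-- The cube of a system in direction `k`. Its first coordinate is an extension map
onto the system, and its second coordinate is invariant in direction `k`. -/
noncomputable def cube (A : MPSystem.{u} r d) (k : Fin d) : MPSystem.{u} r d where
  carrier := A.carrier × A.carrier
  μ := A.cubeMeasure k
  T := A.cubeT k
  isAction :=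
    { map_zero := fun z => by simp [cubeT, A.isAction.map_zero]
      map_add := fun g h z => by simp [cubeT, A.isAction.map_add]
      measurePreserving := A.measurePreserving_cubeT k }

/-- Pulling back along an extension map preserves measurability for the isotropy factors. -/
lemma IsExtension.measurable_isotropy {A B : MPSystem.{u} r d} {ψ : B.carrier → A.carrier}
    (hψ : IsExtension B A ψ) (k : Fin d) : Measurable[B.isotropy k, A.isotropy k] ψ := by
  intro s hs
  refine ⟨hψ.measurePreserving.measurable hs.1, fun γ hγ => ?_⟩
  have h := hψ.measurePreserving.quasiMeasurePreserving.ae_eq (hs.2 γ hγ)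
  have e : B.T γ ⁻¹' (ψ ⁻¹' s) = ψ ⁻¹' (A.T γ ⁻¹' s) := by
    ext y; simp [hψ.intertwines]
  rw [e]
  exact h

/-- The first coordinate of the cube. -/
def cubeFst (A : MPSystem.{u} r d) (k : Fin d) : (A.cube k).carrier → A.carrier :=
  fun z : A.carrier × A.carrier => z.1

/-- The second coordinate of the cube. -/
def cubeSnd (A : MPSystem.{u} r d) (k : Fin d) : (A.cube k).carrier → A.carrier :=
  fun z : A.carrier × A.carrier => z.2

/-- The map of cubes induced by a map of systems. -/
def cubeMap {A B : MPSystem.{u} r d} (ψ : B.carrier → A.carrier) (k : Fin d) :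
    (B.cube k).carrier → (A.cube k).carrier :=
  Prod.map ψ ψ

lemma measurePreserving_cube_fst (A : MPSystem.{u} r d) (k : Fin d) :
    MeasurePreserving (A.cubeFst k) (A.cube k).μ A.μ :=
  ⟨measurable_fst, by
    change (relSquare A.μ (A.isotropy_le k)).fst = A.μ
    rw [relSquare, Measure.fst_compProd]⟩

lemma isExtension_cube_fst (A : MPSystem.{u} r d) (k : Fin d) :
    IsExtension (A.cube k) A (A.cubeFst k) :=
  ⟨A.measurePreserving_cube_fst k, fun _ _ => rfl⟩

lemma measurePreserving_cube_snd (A : MPSystem.{u} r d) (k : Fin d) :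
    MeasurePreserving (A.cubeSnd k) (A.cube k).μ A.μ := by
  refine ⟨measurable_snd, ?_⟩
  change (relSquare A.μ (A.isotropy_le k)).map Prod.snd = A.μ
  refine Measure.ext fun s hs => ?_
  have h1 := integral_relSquare_mul A.μ (A.isotropy_le k) IsUnitBounded.one
    (IsUnitBounded.indicator hs)
  simp only [one_mul] at h1
  rw [integral_condExp (A.isotropy_le k), integral_indicator_const _ hs] at h1
  have h2 : ∫ z : A.carrier × A.carrier, s.indicator (fun _ => (1 : ℂ)) z.2
      ∂(relSquare A.μ (A.isotropy_le k))
        = (relSquare A.μ (A.isotropy_le k)).real (Prod.snd ⁻¹' s) • (1 : ℂ) := by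
    rw [← integral_indicator_const _ (measurable_snd hs)]
    rfl
  rw [h2] at h1
  rw [Measure.map_apply measurable_snd hs,
    ← ENNReal.toReal_eq_toReal_iff' (measure_ne_top _ _) (measure_ne_top _ _)]
  simp only [Complex.real_smul, mul_one] at h1
  exact Complex.ofReal_injective h1

/-- Functoriality of cubes. -/
lemma IsExtension.cube {A B : MPSystem.{u} r d} {ψ : B.carrier → A.carrier}
    (hψ : IsExtension B A ψ) (k : Fin d) :
    IsExtension (B.cube k) (A.cube k) (cubeMap ψ k) := by
  have hm := hψ.measurePreserving.measurable
  have hmm : Measurable (Prod.map ψ ψ) := hm.prodMap hm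
  refine ⟨⟨hmm, ?_⟩, fun g y => Prod.ext (hψ.intertwines _ _) (hψ.intertwines _ _)⟩
  have := Measure.isProbabilityMeasure_map (μ := B.cubeMeasure k) hmm.aemeasurable
  change (B.cubeMeasure k).map (Prod.map ψ ψ) = A.cubeMeasure k
  refine measure_prod_ext_of_integral fun f h hf hh => ?_
  have hfh : IsUnitBounded (fun z : A.carrier × A.carrier => f z.1 * h z.2) :=
    (hf.comp measurable_fst).mul (hh.comp measurable_snd)
  rw [integral_map hmm.aemeasurable hfh.measurable.aestronglyMeasurable]
  obtain ⟨J, hJ⟩ := exists_isFolnerSeq r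
  have h1 := B.tendsto_cubeMeasure k hJ (hf.comp hm) (hh.comp hm)
  have h2 := A.tendsto_cubeMeasure k hJ hf hh
  refine tendsto_nhds_unique (h1.congr fun N => ?_) h2
  congr 1
  ext1 n
  simp only [hψ.intertwines]
  exact integral_comp_measurePreserving hψ.measurePreserving (f := fun x => f x * h (A.T (direction k n) x))
    (hf.mul (hh.comp (A.measurable_T _))).measurable.aestronglyMeasurable

end MPSystem

/-! ### Iterated cubes -/

namespace MPSystem

variable {r d : ℕ} [NeZero d]

/-- Iterated cubes; the head of the list is the direction used last. -/
noncomputable def cubes (A : MPSystem.{u} r d) : List (Fin d) → MPSystem.{u} r d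
  | [] => A
  | k :: L => (cubes A L).cube k

/-- The first vertex of an iterated cube. -/
noncomputable def base (A : MPSystem.{u} r d) : (L : List (Fin d)) → (A.cubes L).carrier → A.carrier
  | [] => id
  | k :: L => base A L ∘ (A.cubes L).cubeFst k

/-- The function `u ⊗ ū` on the cube. -/
def cubeLift (A : MPSystem.{u} r d) (k : Fin d) (u : A.carrier → ℂ) : (A.cube k).carrier → ℂ :=
  fun z => u (A.cubeFst k z) * (starRingEnd ℂ) (u (A.cubeSnd k z))

/-- The tensor power of `u` on an iterated cube, conjugated at the vertices of odd parity. -/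
noncomputable def cubesLift (A : MPSystem.{u} r d) :
    (L : List (Fin d)) → (A.carrier → ℂ) → (A.cubes L).carrier → ℂ
  | [], u => u
  | k :: L, u => (A.cubes L).cubeLift k (cubesLift A L u)

/-- The integral of the tensor power of `u` over an iterated cube: the `2^{|L|}`-th power
of the Host seminorm of `u` along the directions in `L`. -/
noncomputable def cubeForm (A : MPSystem.{u} r d) (L : List (Fin d)) (u : A.carrier → ℂ) : ℂ :=
  ∫ z, A.cubesLift L u z ∂(A.cubes L).μ

/-- The map of iterated cubes induced by a map of systems. -/
noncomputable def cubesMap {A B : MPSystem.{u} r d} (ψ : B.carrier → A.carrier) :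
    (L : List (Fin d)) → (B.cubes L).carrier → (A.cubes L).carrier
  | [] => ψ
  | k :: L => cubeMap (cubesMap ψ L) k

lemma isExtension_base (A : MPSystem.{u} r d) (L : List (Fin d)) :
    IsExtension (A.cubes L) A (A.base L) := by
  induction L with
  | nil => exact ⟨MeasurePreserving.id _, fun _ _ => rfl⟩
  | cons k L ih => exact ih.comp ((A.cubes L).isExtension_cube_fst k)

lemma IsExtension.cubes {A B : MPSystem.{u} r d} {ψ : B.carrier → A.carrier}
    (hψ : IsExtension B A ψ) (L : List (Fin d)) :
    IsExtension (B.cubes L) (A.cubes L) (cubesMap ψ L) := by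
  induction L with
  | nil => exact hψ
  | cons k L ih => exact ih.cube k

lemma _root_.IsUnitBounded.cubeLift {A : MPSystem.{u} r d} {u : A.carrier → ℂ}
    (hu : IsUnitBounded u) (k : Fin d) : IsUnitBounded (A.cubeLift k u) :=
  (hu.comp (A.measurePreserving_cube_fst k).measurable).mul
    (hu.comp (A.measurePreserving_cube_snd k).measurable).conj

lemma _root_.IsUnitBounded.cubesLift {A : MPSystem.{u} r d} {u : A.carrier → ℂ}
    (hu : IsUnitBounded u) (L : List (Fin d)) : IsUnitBounded (A.cubesLift L u) := by
  induction L with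
  | nil => exact hu
  | cons k L ih => exact ih.cubeLift k

lemma cubesLift_mul (A : MPSystem.{u} r d) (L : List (Fin d)) (u v : A.carrier → ℂ) :
    A.cubesLift L (fun x => u x * v x) = fun z => A.cubesLift L u z * A.cubesLift L v z := by
  induction L with
  | nil => rfl
  | cons k L ih =>
    ext1 z
    simp only [cubesLift, cubeLift, ih, map_mul]
    ring

lemma cubesLift_conj (A : MPSystem.{u} r d) (L : List (Fin d)) (u : A.carrier → ℂ) :
    A.cubesLift L (fun x => (starRingEnd ℂ) (u x))
      = fun z => (starRingEnd ℂ) (A.cubesLift L u z) := by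
  induction L with
  | nil => rfl
  | cons k L ih =>
    ext1 z
    simp only [cubesLift, cubeLift, ih, map_mul]

/-- Directions not used in forming the cube act diagonally on it. -/
lemma cubesLift_comp_T (A : MPSystem.{u} r d) {L : List (Fin d)} {k : Fin d} (hk : k ∉ L)
    (n : Fin r → ℤ) (u : A.carrier → ℂ) :
    A.cubesLift L (fun x => u (A.T (direction k n) x))
      = fun z => A.cubesLift L u ((A.cubes L).T (direction k n) z) := by
  induction L with
  | nil => rfl
  | cons j L ih =>
    ext1 z
    rw [List.mem_cons, not_or] at hk
    simp only [cubesLift, cubeLift, ih hk.2]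
    have h := dropDirection_direction_of_ne (Ne.symm hk.1) n
    congr 2
    change (A.cubes L).cubesLift [] _ _ = _
    simp only [cubesLift]
    congr 1
    change (A.cubes L).T _ z.2 = (A.cubes L).T (dropDirection j (direction k n)) z.2
    rw [h]

lemma cubesLift_comp {A B : MPSystem.{u} r d} (ψ : B.carrier → A.carrier) (L : List (Fin d))
    (u : A.carrier → ℂ) :
    B.cubesLift L (fun y => u (ψ y)) = fun z => A.cubesLift L u (cubesMap ψ L z) := by
  induction L with
  | nil => rfl
  | cons k L ih =>
    ext1 z
    simp only [cubesLift, cubeLift, ih]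
    rfl

lemma IsExtension.cubeForm_comp {A B : MPSystem.{u} r d} {ψ : B.carrier → A.carrier}
    (hψ : IsExtension B A ψ) (L : List (Fin d)) {u : A.carrier → ℂ} (hu : IsUnitBounded u) :
    B.cubeForm L (fun y => u (ψ y)) = A.cubeForm L u := by
  rw [cubeForm, cubesLift_comp]
  exact integral_comp_measurePreserving (hψ.cubes L).measurePreserving (
    hu.cubesLift L).measurable.aestronglyMeasurable

lemma integral_norm_cubesLift_sub_le (A : MPSystem.{u} r d) (L : List (Fin d))
    {u v : A.carrier → ℂ} (hu : IsUnitBounded u) (hv : IsUnitBounded v) :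
    ∫ z, ‖A.cubesLift L u z - A.cubesLift L v z‖ ∂(A.cubes L).μ
      ≤ 2 ^ L.length * ∫ x, ‖u x - v x‖ ∂A.μ := by
  induction L with
  | nil => rw [List.length_nil, pow_zero, one_mul]; exact le_rfl
  | cons k L ih =>
    set B := A.cubes L
    set a := A.cubesLift L u
    set b := A.cubesLift L v
    have ha : IsUnitBounded a := hu.cubesLift L
    have hb : IsUnitBounded b := hv.cubesLift L
    have hi : Integrable (fun x => ‖a x - b x‖) B.μ :=
      ((ha.integrable B.μ).sub (hb.integrable B.μ)).norm
    have h1 := (B.measurePreserving_cube_fst k).integrable_comp_of_integrable hi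
    have h2 := (B.measurePreserving_cube_snd k).integrable_comp_of_integrable hi
    have e1 : ∫ z, ‖a (B.cubeFst k z) - b (B.cubeFst k z)‖ ∂(B.cube k).μ = ∫ x, ‖a x - b x‖ ∂B.μ := by
      exact integral_comp_measurePreserving (B.measurePreserving_cube_fst k) hi.aestronglyMeasurable
    have e2 : ∫ z, ‖a (B.cubeSnd k z) - b (B.cubeSnd k z)‖ ∂(B.cube k).μ = ∫ x, ‖a x - b x‖ ∂B.μ := by
      exact integral_comp_measurePreserving (B.measurePreserving_cube_snd k) hi.aestronglyMeasurable
    calc ∫ z, ‖B.cubeLift k a z - B.cubeLift k b z‖ ∂(B.cube k).μ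
        ≤ ∫ z, (‖a (B.cubeFst k z) - b (B.cubeFst k z)‖
            + ‖a (B.cubeSnd k z) - b (B.cubeSnd k z)‖) ∂(B.cube k).μ := by
          refine integral_mono ?_ (h1.add h2) fun z => ?_
          · exact (((ha.cubeLift k).integrable _).sub ((hb.cubeLift k).integrable _)).norm
          · simp only [cubeLift]
            set p := a (B.cubeFst k z)
            set q := b (B.cubeFst k z)
            set p' := a (B.cubeSnd k z)
            set q' := b (B.cubeSnd k z)
            have e : p * (starRingEnd ℂ) p' - q * (starRingEnd ℂ) q'
                = (p - q) * (starRingEnd ℂ) p' + q * (starRingEnd ℂ) (p' - q') := by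
              rw [map_sub]; ring
            rw [e]
            refine (norm_add_le _ _).trans ?_
            rw [norm_mul, norm_mul, RCLike.norm_conj, RCLike.norm_conj]
            have hp' : ‖p'‖ ≤ 1 := ha.norm_le _
            have hq : ‖q‖ ≤ 1 := hb.norm_le _
            exact add_le_add (mul_le_of_le_one_right (norm_nonneg _) hp')
              (mul_le_of_le_one_left (norm_nonneg _) hq)
      _ = 2 * ∫ x, ‖a x - b x‖ ∂B.μ := by
          have := integral_add h1 h2
          simp only [Function.comp_def] at this
          rw [this, e1, e2, two_mul]
      _ ≤ _ := by
          rw [List.length_cons, pow_succ']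
          linarith

/-- On an iterated cube, the tensor power of `u` is the product of `u` at the first vertex and a
function measurable for the join of the isotropy factors: every other vertex is fixed by the side
transformations of some direction. -/
lemma exists_cubesLift_eq_mul (A : MPSystem.{u} r d) (L : List (Fin d)) {u : A.carrier → ℂ}
    (hu : IsUnitBounded u) : ∃ v : (A.cubes L).carrier → ℂ,
      Measurable[⨆ k ∈ L, (A.cubes L).isotropy k] v ∧ IsUnitBounded v ∧
      ∀ z, A.cubesLift L u z = u (A.base L z) * v z := by
  induction L with
  | nil => exact ⟨fun _ => 1, measurable_const, IsUnitBounded.one, fun z => by simp [cubesLift, base]⟩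
  | cons k L ih =>
    obtain ⟨v, hvm, hvb, hv⟩ := ih
    let B := A.cubes L
    have hw : IsUnitBounded (A.cubesLift L u) := hu.cubesLift L
    refine ⟨fun z => v (B.cubeFst k z) * (starRingEnd ℂ) (A.cubesLift L u (B.cubeSnd k z)),
      ?_, ?_, fun z => ?_⟩
    · refine Measurable.mul ?_ (Complex.continuous_conj.measurable.comp ?_)
      · have h1 : Measurable[⨆ j ∈ L, (B.cube k).isotropy j, ⨆ j ∈ L, B.isotropy j]
            (B.cubeFst k) := by
          rw [measurable_iff_comap_le]
          simp only [MeasurableSpace.comap_iSup]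
          refine iSup₂_mono fun j _ => ?_
          exact ((B.isExtension_cube_fst k).measurable_isotropy j).comap_le
        refine (hvm.comp h1).mono ?_ le_rfl
        exact biSup_mono fun j hj => List.mem_cons_of_mem k hj
      · have h2 : Measurable[(B.cube k).isotropy k] (fun z => A.cubesLift L u (B.cubeSnd k z)) := by
          refine measurable_isotropyFactor_of_comp_ae_eq
            (hw.comp (B.measurePreserving_cube_snd k).measurable).measurable ?_
          rintro _ ⟨n, rfl⟩
          refine Eventually.of_forall fun z => ?_
          change A.cubesLift L u (B.T (dropDirection k (direction k n)) z.2) = _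
          rw [dropDirection_direction_self, B.isAction.map_zero]
          rfl
        refine h2.mono ?_ le_rfl
        exact le_iSup₂_of_le k List.mem_cons_self le_rfl
    · exact (hvb.comp (B.measurePreserving_cube_fst k).measurable).mul
        (hw.comp (B.measurePreserving_cube_snd k).measurable).conj
    · change A.cubesLift L u (B.cubeFst k z) * _ = _
      rw [hv, mul_assoc]
      rfl

/-- The mean ergodic theorem in direction `k` computes the next cube form. -/
lemma tendsto_integral_norm_finAvg_sq_cubesLift (A : MPSystem.{u} r d) (k : Fin d)
    (L : List (Fin d)) {J : ℕ → Finset (Fin r → ℤ)} (hJ : IsFolnerSeq J) {u : A.carrier → ℂ}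
    (hu : IsUnitBounded u) :
    Tendsto (fun N => ∫ z, ‖finAvg (J N)
      (fun n => A.cubesLift L u ((A.cubes L).T (direction k n) z))‖ ^ 2 ∂(A.cubes L).μ) atTop
      (𝓝 (A.cubeForm (k :: L) u).re) := by
  set B := A.cubes L
  have hw : IsUnitBounded (A.cubesLift L u) := hu.cubesLift L
  have h := tendsto_integral_norm_finAvg_sq B.isAction (direction k) hJ hw.conj
  simp only [Complex.conj_conj] at h
  have e : A.cubeForm (k :: L) u
      = ∫ x, A.cubesLift L u x * (B.μ[fun x => (starRingEnd ℂ) (A.cubesLift L u x) | B.isotropy k]) x ∂B.μ :=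
    integral_relSquare_mul B.μ (B.isotropy_le k) hw hw.conj
  rw [e]
  refine h.congr fun N => ?_
  congr 1
  ext1 x
  have h1 := map_finAvg (Complex.conjLIE.toLinearEquiv.toLinearMap) (J N)
    (fun n => A.cubesLift L u (B.T (direction k n) x))
  have h2 : finAvg (J N) (fun n => (starRingEnd ℂ) (A.cubesLift L u (B.T (direction k n) x)))
      = (starRingEnd ℂ) (finAvg (J N) (fun n => A.cubesLift L u (B.T (direction k n) x))) := h1.symm
  rw [h2, RCLike.norm_conj]

lemma cubeForm_cons_re_nonneg (A : MPSystem.{u} r d) (k : Fin d) (L : List (Fin d))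
    {u : A.carrier → ℂ} (hu : IsUnitBounded u) : 0 ≤ (A.cubeForm (k :: L) u).re := by
  obtain ⟨J, hJ⟩ := exists_isFolnerSeq r
  exact ge_of_tendsto' (A.tendsto_integral_norm_finAvg_sq_cubesLift k L hJ hu)
    fun N => integral_nonneg fun z => by positivity

/-- The van der Corput recursion satisfied by cube forms. -/
lemma tendsto_finAvg_cubeForm (A : MPSystem.{u} r d) {k : Fin d} {L : List (Fin d)} (hk : k ∉ L)
    {J : ℕ → Finset (Fin r → ℤ)} (hJ : IsFolnerSeq J) {u : A.carrier → ℂ} (hu : IsUnitBounded u) :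
    Tendsto (fun N => finAvg (J N ×ˢ J N) (fun h => (A.cubeForm L (fun x =>
        u (A.T (direction k h.1) x) * (starRingEnd ℂ) (u (A.T (direction k h.2) x)))).re)) atTop
      (𝓝 (A.cubeForm (k :: L) u).re) := by
  refine (A.tendsto_integral_norm_finAvg_sq_cubesLift k L hJ hu).congr fun N => ?_
  set B := A.cubes L
  have hw : IsUnitBounded (A.cubesLift L u) := hu.cubesLift L
  have h1 : ∀ h : (Fin r → ℤ) × (Fin r → ℤ), A.cubeForm L (fun x =>
      u (A.T (direction k h.1) x) * (starRingEnd ℂ) (u (A.T (direction k h.2) x)))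
      = ∫ z, A.cubesLift L u (B.T (direction k h.1) z)
          * (starRingEnd ℂ) (A.cubesLift L u (B.T (direction k h.2) z)) ∂B.μ := by
    intro h
    rw [cubeForm, cubesLift_mul, cubesLift_conj, cubesLift_comp_T _ hk, cubesLift_comp_T _ hk]
  simp only [h1]
  have h2 := map_finAvg Complex.reLm (J N ×ˢ J N) (fun h =>
    ∫ z, A.cubesLift L u (B.T (direction k h.1) z)
      * (starRingEnd ℂ) (A.cubesLift L u (B.T (direction k h.2) z)) ∂B.μ)
  simp only [Complex.reLm_coe] at h2
  rw [← h2, ← integral_finAvg]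
  · have h3 := fun z => finAvg_prod_eq_norm_sq (J N)
      (fun n => A.cubesLift L u (B.T (direction k n) z))
    simp only [h3]
    rw [integral_complex_ofReal, Complex.ofReal_re]
  · exact fun h => ((hw.comp (B.measurable_T _)).mul (hw.comp (B.measurable_T _)).conj).integrable _

end MPSystem

/-! ### Control of nonconventional averages by cube forms -/

lemma integral_norm_le_sqrt {X : Type*} [MeasurableSpace X] {μ : Measure X} [IsProbabilityMeasure μ]
    {b : X → ℂ} (hb : IsUnitBounded b) : ∫ x, ‖b x‖ ∂μ ≤ √(∫ x, ‖b x‖ ^ 2 ∂μ) := by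
  refine Real.le_sqrt_of_sq_le ?_
  set c := ∫ x, ‖b x‖ ∂μ
  have h1 : ∫ x, (‖b x‖ - c) ^ 2 ∂μ = ∫ x, ‖b x‖ ^ 2 ∂μ - 2 * c * c + c ^ 2 := by
    have e : (fun x => (‖b x‖ - c) ^ 2) = fun x => ‖b x‖ ^ 2 - 2 * c * ‖b x‖ + c ^ 2 := by
      ext1 x; ring
    have i1 := hb.integrable_norm_sq μ
    have i2 : Integrable (fun x => 2 * c * ‖b x‖) μ := (hb.integrable μ).norm.const_mul _
    have i12 : Integrable (fun x => ‖b x‖ ^ 2 - 2 * c * ‖b x‖) μ := i1.sub i2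
    rw [e, integral_add i12 (integrable_const _), integral_sub i1 i2, integral_const_mul,
      integral_const]
    simp [c]
  have h2 : 0 ≤ ∫ x, (‖b x‖ - c) ^ 2 ∂μ := integral_nonneg fun x => by positivity
  nlinarith

lemma list_prod_mul_conj {ι : Type*} (K : List ι) (a b : ι → ℂ) :
    (K.map fun i => a i * (starRingEnd ℂ) (b i)).prod
      = (K.map a).prod * (starRingEnd ℂ) (K.map b).prod := by
  induction K with
  | nil => simp
  | cons i K ih => simp only [List.map_cons, List.prod_cons, ih, map_mul]; ring

namespace MPSystem

variable {r d : ℕ}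

/-- The multiplicative derivative of `f` along `ρ`. -/
noncomputable def derivative (A : MPSystem.{u} r d) (ρ : (Fin r → ℤ) → ZGroup r d)
    (f : A.carrier → ℂ) (h : (Fin r → ℤ) × (Fin r → ℤ)) (x : A.carrier) : ℂ :=
  f (A.T (ρ h.1) x) * (starRingEnd ℂ) (f (A.T (ρ h.2) x))

lemma isUnitBounded_derivative (A : MPSystem.{u} r d) (ρ : (Fin r → ℤ) → ZGroup r d)
    {f : A.carrier → ℂ} (hf : IsUnitBounded f) (h : (Fin r → ℤ) × (Fin r → ℤ)) :
    IsUnitBounded (A.derivative ρ f h) :=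
  (hf.comp (A.measurable_T _)).mul (hf.comp (A.measurable_T _)).conj

variable [NeZero d]

/-- The nonconventional averages in which `f` moves along `direction t` and, for `i ∈ K`, the
function `g i` moves along the difference of the directions `t` and `i`. -/
noncomputable def directionAverage (A : MPSystem.{u} r d) (t : Fin d) (K : List (Fin d))
    (f : A.carrier → ℂ) (g : Fin d → A.carrier → ℂ) (J : Finset (Fin r → ℤ)) (x : A.carrier) : ℂ :=
  finAvg J (fun n => f (A.T (direction t n) x)
    * (K.map fun i => g i (A.T (direction t n - direction i n) x)).prod)

lemma isUnitBounded_directionAverage_term (A : MPSystem.{u} r d) (t : Fin d) (K : List (Fin d))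
    {f : A.carrier → ℂ} {g : Fin d → A.carrier → ℂ} (hf : IsUnitBounded f)
    (hg : ∀ i, IsUnitBounded (g i)) (n : Fin r → ℤ) :
    IsUnitBounded (fun x => f (A.T (direction t n) x)
      * (K.map fun i => g i (A.T (direction t n - direction i n) x)).prod) :=
  (hf.comp (A.measurable_T _)).mul
    (IsUnitBounded.list_prod K fun i => (hg i).comp (A.measurable_T _))

lemma isUnitBounded_directionAverage (A : MPSystem.{u} r d) (t : Fin d) (K : List (Fin d))
    {f : A.carrier → ℂ} {g : Fin d → A.carrier → ℂ} (hf : IsUnitBounded f)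
    (hg : ∀ i, IsUnitBounded (g i)) (J : Finset (Fin r → ℤ)) :
    IsUnitBounded (A.directionAverage t K f g J) :=
  IsUnitBounded.finAvg J fun n => A.isUnitBounded_directionAverage_term t K hf hg n

/-- One step of van der Corput's argument, for fixed finite averaging sets: the term with index `j`
is removed, and direction `t` is replaced by direction `j`. -/
lemma integral_norm_directionAverage_sq_le (A : MPSystem.{u} r d) (t j : Fin d) (K : List (Fin d))
    {f : A.carrier → ℂ} {g : Fin d → A.carrier → ℂ} (hf : IsUnitBounded f)
    (hg : ∀ i, IsUnitBounded (g i)) (J F : Finset (Fin r → ℤ)) (hF : F.Nonempty) :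
    ∫ x, ‖A.directionAverage t (j :: K) f g J x‖ ^ 2 ∂A.μ
      ≤ finAvg (F ×ˢ F) (fun h => √(∫ x, ‖A.directionAverage j K
          (A.derivative (direction t) f h)
          (fun i => A.derivative (fun n => direction t n - direction i n) (g i) h) J x‖ ^ 2 ∂A.μ))
        + 2 * finAvg F (fun h => ((J.map (addRightEmbedding h) ∆ J).card : ℝ) / J.card) := by
  set u : (Fin r → ℤ) → A.carrier → ℂ := fun n x => f (A.T (direction t n) x)
    * ((j :: K).map fun i => g i (A.T (direction t n - direction i n) x)).prod with hu_def
  set G : (Fin r → ℤ) × (Fin r → ℤ) → A.carrier → ℂ := fun h =>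
    A.derivative (fun n => direction t n - direction j n) (g j) h
  set w : (Fin r → ℤ) × (Fin r → ℤ) → (Fin r → ℤ) → A.carrier → ℂ := fun h n x =>
    A.derivative (direction t) f h (A.T (direction j n) x) * (K.map fun i =>
      A.derivative (fun n => direction t n - direction i n) (g i) h
        (A.T (direction j n - direction i n) x)).prod
  set err := finAvg F (fun h => ((J.map (addRightEmbedding h) ∆ J).card : ℝ) / J.card)
  have hu : ∀ n, IsUnitBounded (u n) := fun n =>
    A.isUnitBounded_directionAverage_term t (j :: K) hf hg n
  have hG : ∀ h, IsUnitBounded (G h) := fun h => A.isUnitBounded_derivative _ (hg j) h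
  have hw : ∀ h n, IsUnitBounded (w h n) := fun h n =>
    A.isUnitBounded_directionAverage_term j K (A.isUnitBounded_derivative _ hf h)
      (fun i => A.isUnitBounded_derivative _ (hg i) h) n
  have huu : ∀ (h : (Fin r → ℤ) × (Fin r → ℤ)) n,
      IsUnitBounded (fun x => u (n + h.1) x * (starRingEnd ℂ) (u (n + h.2) x)) :=
    fun h n => (hu _).mul (hu _).conj
  -- after the translation by `direction t n - direction j n`, the function `g j` no longer moves
  have hshift : ∀ h n x, u (n + h.1) x * (starRingEnd ℂ) (u (n + h.2) x)
      = G h (A.T (direction t n - direction j n) x)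
        * w h n (A.T (direction t n - direction j n) x) := by
    intro h n x
    have e : ∀ (i : Fin d) (m : Fin r → ℤ),
        A.T (direction t m - direction i m)
          (A.T (direction j n - direction i n) (A.T (direction t n - direction j n) x))
        = A.T (direction t (n + m) - direction i (n + m)) x := by
      intro i m
      rw [← A.isAction.map_add, ← A.isAction.map_add, map_add, map_add]
      congr 1
      abel
    have e0 : ∀ m : Fin r → ℤ, A.T (direction t m)
          (A.T (direction j n) (A.T (direction t n - direction j n) x))
        = A.T (direction t (n + m)) x := by
      intro m
      rw [← A.isAction.map_add, ← A.isAction.map_add, map_add]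
      congr 1
      abel
    have e1 : ∀ m : Fin r → ℤ, A.T (direction t m - direction j m)
          (A.T (direction t n - direction j n) x)
        = A.T (direction t (n + m) - direction j (n + m)) x := by
      intro m
      rw [← A.isAction.map_add, map_add, map_add]
      congr 1
      abel
    simp only [hu_def, G, w, derivative, e, e0, e1, list_prod_mul_conj, List.map_cons,
      List.prod_cons, map_mul]
    ring
  have hint : ∀ h n, ∫ x, u (n + h.1) x * (starRingEnd ℂ) (u (n + h.2) x) ∂A.μ
      = ∫ x, G h x * w h n x ∂A.μ := by
    intro h n
    simp only [hshift]
    exact integral_comp_measurePreserving (A.isAction.measurePreserving _)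
      (f := fun x => G h x * w h n x) ((hG h).mul (hw h n)).measurable.aestronglyMeasurable
  have hterm : ∀ h, finAvg J (fun n => ∫ x,
      (u (n + h.1) x * (starRingEnd ℂ) (u (n + h.2) x)).re ∂A.μ)
      ≤ √(∫ x, ‖finAvg J (fun n => w h n x)‖ ^ 2 ∂A.μ) := by
    intro h
    have hav : IsUnitBounded (fun x => finAvg J (fun n => w h n x)) :=
      IsUnitBounded.finAvg J (hw h)
    have e1 : finAvg J (fun n => ∫ x, (u (n + h.1) x * (starRingEnd ℂ) (u (n + h.2) x)).re ∂A.μ)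
        = (∫ x, G h x * finAvg J (fun n => w h n x) ∂A.μ).re := by
      have e2 : ∀ n, ∫ x, (u (n + h.1) x * (starRingEnd ℂ) (u (n + h.2) x)).re ∂A.μ
          = Complex.reLm (∫ x, G h x * w h n x ∂A.μ) := by
        intro n
        rw [← hint]
        exact integral_re ((huu h n).integrable A.μ)
      simp only [e2, ← map_finAvg]
      rw [← integral_finAvg _ fun n => ((hG h).mul (hw h n)).integrable A.μ]
      simp only [finAvg_mul_left, Complex.reLm_coe]
    rw [e1]
    refine (Complex.re_le_norm _).trans ((norm_integral_le_integral_norm _).trans ?_)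
    refine le_trans (integral_mono (((hG h).mul hav).integrable A.μ).norm (hav.integrable A.μ).norm
      fun x => ?_) (integral_norm_le_sqrt hav)
    rw [norm_mul]
    exact mul_le_of_le_one_left (norm_nonneg _) ((hG h).norm_le x)
  have i1 : ∀ n, Integrable (fun x => finAvg (F ×ˢ F)
      (fun h => (u (n + h.1) x * (starRingEnd ℂ) (u (n + h.2) x)).re)) A.μ := fun n =>
    integrable_finAvg _ fun h => ((huu h n).integrable A.μ).re
  calc ∫ x, ‖A.directionAverage t (j :: K) f g J x‖ ^ 2 ∂A.μ
      ≤ ∫ x, (finAvg J (fun n => finAvg (F ×ˢ F)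
          (fun h => (u (n + h.1) x * (starRingEnd ℂ) (u (n + h.2) x)).re)) + 2 * err) ∂A.μ := by
        refine integral_mono ((IsUnitBounded.finAvg J hu).integrable_norm_sq A.μ) ?_ fun x =>
          norm_finAvg_sq_le_vanDerCorput J F hF fun n => (hu n).norm_le x
        exact (integrable_finAvg J i1).add (integrable_const _)
    _ = finAvg (F ×ˢ F) (fun h => finAvg J (fun n => ∫ x,
          (u (n + h.1) x * (starRingEnd ℂ) (u (n + h.2) x)).re ∂A.μ)) + 2 * err := by
        rw [integral_add (integrable_finAvg J i1) (integrable_const _),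
          integral_finAvg _ i1, integral_const]
        simp only [probReal_univ, one_smul]
        rw [finAvg_comm (F ×ˢ F) J]
        congr 2
        ext1 n
        exact integral_finAvg _ fun h => ((huu h n).integrable A.μ).re
    _ ≤ _ := add_le_add (finAvg_mono fun h _ => hterm h) le_rfl

/-- Nonconventional averages are controlled by the cube form of `f`: the bound depends neither on
the Følner sequence nor on the other functions. By induction on `K`, the van der Corput step and
the recursion for cube forms each add one direction. -/
lemma eventually_integral_norm_directionAverage_sq_le (A : MPSystem.{u} r d) (K : List (Fin d)) :
    ∀ (t : Fin d), (t :: K).Nodup → ∀ {J : ℕ → Finset (Fin r → ℤ)}, IsFolnerSeq J →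
    ∀ {f : A.carrier → ℂ} {g : Fin d → A.carrier → ℂ}, IsUnitBounded f →
    (∀ i, IsUnitBounded (g i)) → ∀ {c : ℝ}, 0 ≤ c →
    (A.cubeForm (t :: K) f).re < c ^ 2 ^ K.length →
    ∀ᶠ N in atTop, ∫ x, ‖A.directionAverage t K f g (J N) x‖ ^ 2 ∂A.μ ≤ c := by
  induction K with
  | nil =>
    intro t _ J hJ f g hf hg c _ hQ
    have h := A.tendsto_integral_norm_finAvg_sq_cubesLift t [] hJ hf
    rw [List.length_nil, pow_zero, pow_one] at hQ
    filter_upwards [h.eventually_lt_const hQ] with N hN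
    simp only [directionAverage, List.map_nil, List.prod_nil, mul_one]
    exact hN.le
  | cons j K ih =>
    intro t hnd J hJ f g hf hg c hc hQ
    obtain ⟨htK, hnd'⟩ := List.nodup_cons.1 hnd
    set m := 2 ^ (j :: K).length with hm
    have hm0 : m ≠ 0 := by positivity
    have hm2 : m = 2 * 2 ^ K.length := by rw [hm, List.length_cons, pow_succ']
    have hQ0 : 0 ≤ (A.cubeForm (t :: j :: K) f).re := A.cubeForm_cons_re_nonneg t _ hf
    have hcpos : 0 < c := by
      rcases hc.eq_or_lt with rfl | h
      · rw [zero_pow hm0] at hQ; exact absurd hQ0 (not_le.2 hQ)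
      · exact h
    obtain ⟨c', hc', hc'c, hQc'⟩ : ∃ c', 0 < c' ∧ c' < c ∧
        (A.cubeForm (t :: j :: K) f).re < c' ^ m := by
      have h1 : ∀ᶠ y in 𝓝[<] c, (A.cubeForm (t :: j :: K) f).re < y ^ m :=
        nhdsWithin_le_nhds ((continuous_pow m).continuousAt.eventually (lt_mem_nhds hQ))
      have h2 : ∀ᶠ y in 𝓝[<] c, 0 < y := nhdsWithin_le_nhds (lt_mem_nhds hcpos)
      obtain ⟨y, hy1, hy2, hy3⟩ := (h1.and (h2.and self_mem_nhdsWithin)).exists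
      exact ⟨y, hy2, hy3, hy1⟩
    set q : (Fin r → ℤ) × (Fin r → ℤ) → ℝ := fun h =>
      (A.cubeForm (j :: K) (A.derivative (direction t) f h)).re
    have hq0 : ∀ h, 0 ≤ q h := fun h =>
      A.cubeForm_cons_re_nonneg j K (A.isUnitBounded_derivative _ hf h)
    obtain ⟨F, hF, hFq⟩ : ∃ F : Finset (Fin r → ℤ), F.Nonempty ∧ finAvg (F ×ˢ F) q < c' ^ m := by
      obtain ⟨N, h1, h2⟩ := (((A.tendsto_finAvg_cubeForm htK hJ hf).eventually_lt_const hQc').and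
        hJ.eventually_nonempty).exists
      exact ⟨J N, h2, h1⟩
    have hFF : (F ×ˢ F).Nonempty := hF.product hF
    set η := c' ^ m - finAvg (F ×ˢ F) q with hη
    have hη0 : 0 < η := sub_pos.2 hFq
    have hroot : ∀ h, ∃ b : ℝ, 0 ≤ b ∧ b ^ 2 ^ K.length = q h + η / 2 := fun h =>
      ⟨(q h + η / 2) ^ (((2 ^ K.length : ℕ) : ℝ)⁻¹),
        Real.rpow_nonneg (by linarith [hq0 h]) _,
        Real.rpow_inv_natCast_pow (by linarith [hq0 h]) (by positivity)⟩
    choose b hb0 hb using hroot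
    have hev : ∀ᶠ N in atTop, ∀ h ∈ F ×ˢ F, ∫ x, ‖A.directionAverage j K
          (A.derivative (direction t) f h)
          (fun i => A.derivative (fun n => direction t n - direction i n) (g i) h) (J N) x‖ ^ 2 ∂A.μ
          ≤ b h := by
      rw [eventually_all_finset]
      intro h _
      refine ih j hnd' hJ (A.isUnitBounded_derivative _ hf h)
        (fun i => A.isUnitBounded_derivative _ (hg i) h) (hb0 h) ?_
      rw [hb]
      change q h < q h + η / 2
      linarith
    have herr : ∀ᶠ N in atTop, 2 * finAvg F
        (fun h => (((J N).map (addRightEmbedding h) ∆ J N).card : ℝ) / (J N).card) < c - c' := by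
      have := (hJ.tendsto_error F).const_mul 2
      rw [mul_zero] at this
      exact this.eventually_lt_const (sub_pos.2 hc'c)
    have hroots : finAvg (F ×ˢ F) (fun h => √(b h)) ≤ c' := by
      refine (lt_of_pow_lt_pow_left₀ m hc'.le ?_).le
      refine (finAvg_pow_le hFF (fun h _ => Real.sqrt_nonneg _) m).trans_lt ?_
      have e : ∀ h, √(b h) ^ m = q h + η / 2 := fun h => by
        rw [hm2, pow_mul, Real.sq_sqrt (hb0 h), hb]
      simp only [e]
      rw [finAvg_add, finAvg_const hFF]
      linarith
    filter_upwards [hev, herr] with N h1 h2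
    refine (A.integral_norm_directionAverage_sq_le t j K hf hg (J N) F hF).trans ?_
    have h3 := finAvg_mono fun h hh => Real.sqrt_le_sqrt (h1 h hh)
    linarith

end MPSystem

/-! ### Inverse limits of systems -/

section InverseLimitMeasure

open ProbabilityTheory Preorder

lemma compProd_comap_map {X Y Z : Type*} [MeasurableSpace X] [MeasurableSpace Y]
    [MeasurableSpace Z] (μ : Measure X) [IsProbabilityMeasure μ] {f : X → Y} (hf : Measurable f)
    (κ : Kernel Y Z) [IsMarkovKernel κ] :
    (μ ⊗ₘ κ.comap f hf).map (Prod.map f id) = μ.map f ⊗ₘ κ := by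
  have : IsProbabilityMeasure (μ.map f) := Measure.isProbabilityMeasure_map hf.aemeasurable
  have hm : Measurable (Prod.map f (id : Z → Z)) := hf.prodMap measurable_id
  have := Measure.isProbabilityMeasure_map (μ := μ ⊗ₘ κ.comap f hf) hm.aemeasurable
  refine Measure.ext_prod fun {s t} hs ht => ?_
  rw [Measure.map_apply hm (hs.prod ht), Measure.compProd_apply_prod hs ht,
    setLIntegral_map hs (κ.measurable_coe ht) hf]
  have e : Prod.map f (id : Z → Z) ⁻¹' (s ×ˢ t) = (f ⁻¹' s) ×ˢ t := by
    ext z; simp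
  rw [e, Measure.compProd_apply_prod (hf hs) ht]
  rfl

variable {X : ℕ → Type u} [∀ n, MeasurableSpace (X n)] [∀ n, StandardBorelSpace (X n)]
  (ν : ∀ n, Measure (X n)) [∀ n, IsProbabilityMeasure (ν n)] {π : ∀ n, X (n + 1) → X n}

/-- Kolmogorov's theorem for a tower of standard Borel probability spaces: there is a measure
on the product whose marginals are the given ones and for which almost every point is a
consistent sequence. It is the law of the Markov chain whose transitions are the conditional laws
of the tower. -/
lemma exists_measure_of_tower (hπ : ∀ n, MeasurePreserving (π n) (ν (n + 1)) (ν n)) :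
    ∃ P : Measure (∀ n, X n), IsProbabilityMeasure P ∧ (∀ n, P.map (fun x => x n) = ν n) ∧
      ∀ᵐ x ∂P, ∀ n, π n (x (n + 1)) = x n := by
  have hne : ∀ n, Nonempty (X n) := fun n => (ν n).nonempty_of_neZero
  have hev : ∀ n : ℕ, Measurable (fun h : ((i : Finset.Iic n) → X i) =>
      h ⟨n, Finset.mem_Iic.2 le_rfl⟩) := fun n => measurable_pi_apply _
  have hpair : ∀ n, Measurable (fun z => (π n z, z)) := fun n =>
    (hπ n).measurable.prodMk measurable_id
  set κ₀ : ∀ n, Kernel (X n) (X (n + 1)) := fun n => condDistrib id (π n) (ν (n + 1))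
  set κ : ∀ n : ℕ, Kernel ((i : Finset.Iic n) → X i) (X (n + 1)) := fun n => (κ₀ n).comap _ (hev n)
  set P := Kernel.trajMeasure (ν 0) κ with hP
  have hstep : ∀ n, P.map (fun x => x n) = ν n →
      P.map (fun x => (x n, x (n + 1))) = (ν (n + 1)).map (fun z => (π n z, z)) := by
    intro n hn
    have h1 := Kernel.map_frestrictLe_trajMeasure_compProd_eq_map_trajMeasure (κ := κ) (μ₀ := ν 0)
      (a := n)
    have hfr : Measurable (frestrictLe (π := X) n) := measurable_frestrictLe n
    have := Measure.isProbabilityMeasure_map (μ := P) hfr.aemeasurable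
    have h2 := compProd_comap_map (P.map (frestrictLe n)) (hev n) (κ₀ n)
    rw [h1, Measure.map_map ((hev n).prodMap measurable_id) (by fun_prop),
      Measure.map_map (hev n) hfr] at h2
    have h3 := compProd_map_condDistrib (mβ := inferInstance) (μ := ν (n + 1)) (X := π n)
      (Y := id) measurable_id.aemeasurable
    rw [(hπ n).map_eq, ← hn] at h3
    exact h2.trans h3
  have hmarg : ∀ n, P.map (fun x => x n) = ν n := by
    intro n
    induction n with
    | zero =>
      obtain ⟨e, he, hev0, h1⟩ : ∃ e : X 0 → ((i : Finset.Iic 0) → X i), Measurable e ∧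
          (∀ x, e x ⟨0, Finset.mem_Iic.2 le_rfl⟩ = x) ∧ P.map (frestrictLe 0) = (ν 0).map e := by
        refine ⟨(MeasurableEquiv.piUnique (fun i : Finset.Iic 0 => X i)).symm,
          MeasurableEquiv.measurable _, fun x => ?_, ?_⟩
        · exact uniqueElim_default (α := fun i : Finset.Iic 0 => X i) x
        · rw [hP, Kernel.trajMeasure, Measure.map_comp _ _ (measurable_frestrictLe 0),
            Kernel.traj_map_frestrictLe, Kernel.partialTraj_self]
          exact Measure.id_comp
      have h2 := congrArg (Measure.map (fun h => h ⟨0, Finset.mem_Iic.2 le_rfl⟩)) h1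
      rw [Measure.map_map (hev 0) (measurable_frestrictLe 0), Measure.map_map (hev 0) he] at h2
      refine h2.trans ?_
      have e0 : (fun h : ((i : Finset.Iic 0) → X i) => h ⟨0, Finset.mem_Iic.2 le_rfl⟩) ∘ e = id :=
        funext hev0
      rw [e0, Measure.map_id]
    | succ n ih =>
      have h1 := congrArg (Measure.map Prod.snd) (hstep n ih)
      rw [Measure.map_map measurable_snd (by fun_prop),
        Measure.map_map measurable_snd (hpair n)] at h1
      exact h1.trans Measure.map_id
  refine ⟨P, inferInstance, hmarg, ?_⟩
  rw [ae_all_iff]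
  intro n
  have hS : MeasurableSet {z : X n × X (n + 1) | π n z.2 = z.1} :=
    measurableSet_eq_fun ((hπ n).measurable.comp measurable_snd) measurable_fst
  have h1 : ∀ᵐ z ∂(P.map (fun x => (x n, x (n + 1)))), π n z.2 = z.1 := by
    rw [hstep n (hmarg n), ae_map_iff (hpair n).aemeasurable hS]
    exact Eventually.of_forall fun _ => rfl
  exact (ae_map_iff (by fun_prop) hS).1 h1

end InverseLimitMeasure

namespace MPSystem

variable {r d : ℕ}

/-- Every tower of systems has an inverse limit, whose σ-algebra is generated by the
projections to the stages of the tower. -/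
lemma exists_inverseLimit (A : ℕ → MPSystem.{u} r d) (π : ∀ n, (A (n + 1)).carrier → (A n).carrier)
    (hπ : ∀ n, IsExtension (A (n + 1)) (A n) (π n)) :
    ∃ (Y : MPSystem.{u} r d) (p : ∀ n, Y.carrier → (A n).carrier),
      (∀ n, IsExtension Y (A n) (p n)) ∧ (∀ n y, π n (p (n + 1) y) = p n y) ∧
      Monotone (fun n => (A n).measurableSpace.comap (p n)) ∧
      Y.measurableSpace = ⨆ n, (A n).measurableSpace.comap (p n) := by
  obtain ⟨P, hP, hmarg, hcons⟩ := exists_measure_of_tower (fun n => (A n).μ)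
    (fun n => (hπ n).measurePreserving)
  set S : Set (∀ n, (A n).carrier) := {x | ∀ n, π n (x (n + 1)) = x n}
  have hS : MeasurableSet S := by
    have : S = ⋂ n, {x | π n (x (n + 1)) = x n} := by ext x; simp [S]
    rw [this]
    exact MeasurableSet.iInter fun n => measurableSet_eq_fun
      ((hπ n).measurePreserving.measurable.comp (measurable_pi_apply _)) (measurable_pi_apply _)
  have hsb : StandardBorelSpace S := hS.standardBorel
  set ν : Measure S := P.comap Subtype.val
  have hνmap : ν.map Subtype.val = P := by
    rw [map_comap_subtype_coe hS]
    exact Measure.restrict_eq_self_of_ae_mem hcons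
  have hν : IsProbabilityMeasure ν := by
    have : IsProbabilityMeasure (ν.map Subtype.val) := by rw [hνmap]; exact hP
    exact Measure.isProbabilityMeasure_of_map Subtype.val
  set p : ∀ n, S → (A n).carrier := fun n y => y.1 n
  have hpm : ∀ n, Measurable (p n) := fun n => (measurable_pi_apply n).comp measurable_subtype_coe
  have hpν : ∀ n, ν.map (p n) = (A n).μ := by
    intro n
    rw [← hmarg n, ← hνmap, Measure.map_map (measurable_pi_apply n) measurable_subtype_coe]
    rfl
  have hgen : (inferInstance : MeasurableSpace S) = ⨆ n, (A n).measurableSpace.comap (p n) := by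
    change MeasurableSpace.comap Subtype.val (⨆ n, _) = _
    rw [MeasurableSpace.comap_iSup]
    simp only [MeasurableSpace.comap_comp]
    rfl
  have hmono : Monotone fun n => (A n).measurableSpace.comap (p n) := by
    refine monotone_nat_of_le_succ fun n => ?_
    have e : p n = π n ∘ p (n + 1) := by ext1 y; exact (y.2 n).symm
    rw [e, ← MeasurableSpace.comap_comp]
    exact MeasurableSpace.comap_mono (hπ n).measurePreserving.measurable.comap_le
  -- a measure on the limit is determined by its images at the stages of the tower
  have hext : ∀ ν' : Measure S, (∀ n, ν'.map (p n) = (A n).μ) → ν = ν' := by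
    intro ν' hν'
    have hs' : ∀ n (t : Set (A n).carrier), MeasurableSet t → ν (p n ⁻¹' t) = ν' (p n ⁻¹' t) := by
      intro n t ht
      rw [← Measure.map_apply (hpm n) ht, ← Measure.map_apply (hpm n) ht, hpν, hν']
    refine ext_of_generate_finite
      (⋃ n, {t | MeasurableSet[(A n).measurableSpace.comap (p n)] t}) ?_ ?_ ?_ ?_
    · exact hgen.trans (MeasurableSpace.generateFrom_iUnion_measurableSet _).symm
    · refine isPiSystem_iUnion_of_monotone _ (fun n => ?_) fun m n hmn => hmono hmn
      exact @MeasurableSpace.isPiSystem_measurableSet _ ((A n).measurableSpace.comap (p n))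
    · intro s hs
      obtain ⟨n, t, ht, rfl⟩ := Set.mem_iUnion.1 hs
      exact hs' n t ht
    · exact hs' 0 Set.univ MeasurableSet.univ
  set T : ZGroup r d → S → S := fun g y =>
    ⟨fun n => (A n).T g (p n y), fun n => by rw [(hπ n).intertwines]; exact congrArg _ (y.2 n)⟩
  have hTm : ∀ g, Measurable (T g) := fun g =>
    (measurable_pi_lambda _ fun n => ((A n).measurable_T g).comp (hpm n)).subtype_mk
  have hT : IsPreservingAction ν T :=
    { map_zero := fun y => Subtype.ext (funext fun n => (A n).isAction.map_zero _)
      map_add := fun g h y => Subtype.ext (funext fun n => (A n).isAction.map_add g h _)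
      measurePreserving := fun g => ⟨hTm g, by
        refine (hext _ fun n => ?_).symm
        rw [Measure.map_map (hpm n) (hTm g), ← ((A n).isAction.measurePreserving g).map_eq, ← hpν n,
          Measure.map_map ((A n).measurable_T g) (hpm n)]
        rfl⟩ }
  exact ⟨⟨S, ν, T, hT⟩, p, fun n => ⟨⟨hpm n, hpν n⟩, fun g y => rfl⟩, fun n y => y.2 n, hmono,
    hgen⟩

end MPSystem

/-! ### The tower of cubes and its inverse limit -/

lemma integral_mul_condExp_of_measurable {X : Type*} {m m₀ : MeasurableSpace X} {μ : Measure X}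
    [IsProbabilityMeasure μ] (hm : m ≤ m₀) {f g : X → ℂ} (hg : Measurable[m] g)
    (hg' : IsUnitBounded g) (hf : IsUnitBounded f) :
    ∫ x, g x * (μ[f | m]) x ∂μ = ∫ x, g x * f x ∂μ := by
  have h := condExp_bilin_of_stronglyMeasurable_left (m := m) (μ := μ) (.mul ℝ ℂ)
    hg.stronglyMeasurable ((hg'.mul hf).integrable μ) (hf.integrable μ)
  rw [← integral_condExp hm (f := fun x => g x * f x)]
  exact (integral_congr_ae h).symm

lemma abs_clamp_sub_le {a x y : ℝ} (hx : |x| ≤ a) : |max (-a) (min a y) - x| ≤ |y - x| := by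
  obtain ⟨h1, h2⟩ := abs_le.1 hx
  rcases le_total a y with h | h
  · rw [min_eq_left h, max_eq_right (by linarith), abs_of_nonneg (by linarith),
      abs_of_nonneg (by linarith)]
    linarith
  · rw [min_eq_right h]
    rcases le_total (-a) y with h' | h'
    · rw [max_eq_right h']
    · rw [max_eq_left h', abs_of_nonpos (by linarith), abs_of_nonpos (by linarith)]
      linarith

/-- Bounded functions are approximated in `L¹` by bounded functions lifted along the maps `p n`,
when these generate the σ-algebra in an increasing way. -/
lemma exists_approx_of_iSup_comap {Y : Type*} {X : ℕ → Type*} [mY : MeasurableSpace Y]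
    [∀ n, MeasurableSpace (X n)] {ν : Measure Y} [IsProbabilityMeasure ν] {p : ∀ n, Y → X n}
    (hp : ∀ n, Measurable (p n))
    (hmono : Monotone fun n => (inferInstance : MeasurableSpace (X n)).comap (p n))
    (hgen : mY = ⨆ n, (inferInstance : MeasurableSpace (X n)).comap (p n))
    {f : Y → ℂ} (hf : Measurable f) (hf' : ∀ y, ‖f y‖ ≤ 1 / 2) {ε : ℝ} (hε : 0 < ε) :
    ∃ n, ∃ φ : X n → ℂ, IsUnitBounded φ ∧ ∫ y, ‖f y - φ (p n y)‖ ∂ν ≤ ε := by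
  set ℱ : Filtration ℕ mY := ⟨fun n => (inferInstance : MeasurableSpace (X n)).comap (p n), hmono,
    fun n => (hp n).comap_le⟩
  -- martingale convergence for a bounded real function, followed by truncation
  have hreal : ∀ g : Y → ℝ, Measurable g → (∀ y, |g y| ≤ 1 / 2) → ∀ᶠ n in atTop,
      ∃ ψ : X n → ℝ, Measurable ψ ∧ (∀ x, |ψ x| ≤ 1 / 2) ∧ ∫ y, |g y - ψ (p n y)| ∂ν ≤ ε / 2 := by
    intro g hg hg'
    have hgi : Integrable g ν := Integrable.of_bound hg.aestronglyMeasurable (1 / 2)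
      (Eventually.of_forall hg')
    have hgm : StronglyMeasurable[⨆ n, ℱ n] g := by
      refine Measurable.stronglyMeasurable ?_
      have e : (⨆ n, (ℱ n : MeasurableSpace Y)) = mY := hgen.symm
      rw [e]
      exact hg
    have h := hgi.tendsto_eLpNorm_condExp hgm
    filter_upwards [h.eventually_lt_const (ENNReal.ofReal_pos.2 (half_pos hε))] with n hn
    obtain ⟨ψ, hψ, hψe⟩ := (stronglyMeasurable_condExp (μ := ν) (m := ℱ n)
      (f := g)).measurable.exists_eq_measurable_comp
    refine ⟨fun x => max (-(1 / 2)) (min (1 / 2) (ψ x)),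
      measurable_const.max (measurable_const.min hψ), fun x => abs_le.2 ⟨le_max_left _ _,
        max_le (by norm_num) (min_le_left _ _)⟩, ?_⟩
    have hi : Integrable (fun y => ν[g | ℱ n] y - g y) ν := integrable_condExp.sub hgi
    calc ∫ y, |g y - max (-(1 / 2)) (min (1 / 2) (ψ (p n y)))| ∂ν
        ≤ ∫ y, ‖ν[g | ℱ n] y - g y‖ ∂ν := by
          refine integral_mono_of_nonneg (Eventually.of_forall fun y => abs_nonneg _) hi.norm
            (Eventually.of_forall fun y => ?_)
          simp only
          rw [abs_sub_comm, Real.norm_eq_abs, hψe]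
          exact abs_clamp_sub_le (hg' y)
      _ ≤ ε / 2 := by
          rw [integral_norm_eq_lintegral_enorm hi.aestronglyMeasurable]
          refine ENNReal.toReal_le_of_le_ofReal (half_pos hε).le ?_
          rw [← eLpNorm_one_eq_lintegral_enorm]
          exact hn.le
  obtain ⟨n, ⟨ψ₁, h1, h1b, h1e⟩, ψ₂, h2, h2b, h2e⟩ := ((hreal (fun y => (f y).re)
    (Complex.measurable_re.comp hf) fun y => (Complex.abs_re_le_norm _).trans (hf' y)).and
    (hreal (fun y => (f y).im) (Complex.measurable_im.comp hf)
      fun y => (Complex.abs_im_le_norm _).trans (hf' y))).exists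
  have key : ∀ a b : ℝ, ‖(a : ℂ) + b * Complex.I‖ ≤ |a| + |b| := fun a b => by
    refine (norm_add_le _ _).trans ?_
    simp
  refine ⟨n, fun x => (ψ₁ x : ℂ) + ψ₂ x * Complex.I, ⟨?_, fun x => ?_⟩, ?_⟩
  · exact (Complex.measurable_ofReal.comp h1).add
      ((Complex.measurable_ofReal.comp h2).mul measurable_const)
  · refine (key _ _).trans ?_
    linarith [h1b x, h2b x]
  · have i1 : Integrable (fun y => |(f y).re - ψ₁ (p n y)|) ν :=
      Integrable.of_bound (((Complex.measurable_re.comp hf).sub (h1.comp (hp n))).norm).aestronglyMeasurable 1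
        (Eventually.of_forall fun y => by
          rw [Real.norm_eq_abs, abs_abs]
          refine (abs_sub _ _).trans ?_
          linarith [h1b (p n y), (Complex.abs_re_le_norm (f y)).trans (hf' y)])
    have i2 : Integrable (fun y => |(f y).im - ψ₂ (p n y)|) ν :=
      Integrable.of_bound (((Complex.measurable_im.comp hf).sub (h2.comp (hp n))).norm).aestronglyMeasurable 1
        (Eventually.of_forall fun y => by
          rw [Real.norm_eq_abs, abs_abs]
          refine (abs_sub _ _).trans ?_
          linarith [h2b (p n y), (Complex.abs_im_le_norm (f y)).trans (hf' y)])
    calc ∫ y, ‖f y - ((ψ₁ (p n y) : ℂ) + ψ₂ (p n y) * Complex.I)‖ ∂ν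
        ≤ ∫ y, (|(f y).re - ψ₁ (p n y)| + |(f y).im - ψ₂ (p n y)|) ∂ν := by
          refine integral_mono_of_nonneg (Eventually.of_forall fun y => norm_nonneg _) (i1.add i2)
            (Eventually.of_forall fun y => ?_)
          have e : f y - ((ψ₁ (p n y) : ℂ) + ψ₂ (p n y) * Complex.I)
              = (((f y).re - ψ₁ (p n y) : ℝ) : ℂ) + ((f y).im - ψ₂ (p n y) : ℝ) * Complex.I := by
            apply Complex.ext <;> simp
          simp only
          rw [e]
          exact key _ _
      _ ≤ ε := by
          rw [integral_add i1 i2]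
          linarith

namespace MPSystem

variable {r d : ℕ} [NeZero d]

lemma isotropy_le_pleasantFactor (A : MPSystem.{u} r d) (k : Fin d) :
    A.isotropy k ≤ pleasantFactor A.μ A.T := by
  by_cases hk : k = 0
  · subst hk
    have e : direction (r := r) (0 : Fin d) = blockEmb 0 := by simp [direction]
    rw [isotropy, e]
    exact le_sup_left
  · refine le_trans (le_of_eq ?_) (le_sup_of_le_right (le_iSup₂_of_le k hk le_rfl))
    have e : (direction (r := r) k).range = (blockEmb (r := r) k - blockEmb 0).range := by
      have e1 : direction (r := r) k = -(blockEmb k - blockEmb 0) := by simp [direction, hk]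
      rw [e1]
      ext g
      constructor
      · rintro ⟨n, rfl⟩
        exact ⟨-n, by simp; abel⟩
      · rintro ⟨n, rfl⟩
        exact ⟨-n, by simp; abel⟩
    rw [isotropy, e]

lemma pleasantFactor_le (A : MPSystem.{u} r d) : pleasantFactor A.μ A.T ≤ A.measurableSpace :=
  sup_le isotropyFactor_le (iSup₂_le fun _ _ => isotropyFactor_le)

/-- The tower in which every stage is the iterated cube of the previous one. -/
noncomputable def cubeTower (A : MPSystem.{u} r d) (L : List (Fin d)) : ℕ → MPSystem.{u} r d
  | 0 => A
  | n + 1 => (cubeTower A L n).cubes L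

/-- If `f` is orthogonal to the pleasant factor and is close to the lift of a function `φ` on a
system `B`, and the system at hand lies over the iterated cube of `B`, then the cube form
of `f` is small: up to the error, it is the integral of `f` against the product of `φ` over the
other vertices of the cube, which is measurable for the pleasant factor. -/
lemma norm_cubeForm_le_of_approx {Y B : MPSystem.{u} r d} {L : List (Fin d)}
    {p : Y.carrier → B.carrier} {q : Y.carrier → (B.cubes L).carrier}
    (hp : IsExtension Y B p) (hq : IsExtension Y (B.cubes L) q) (hpq : ∀ y, B.base L (q y) = p y)
    {f : Y.carrier → ℂ} (hf : IsUnitBounded f)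
    (hE : Y.μ[f | pleasantFactor Y.μ Y.T] =ᵐ[Y.μ] 0) {φ : B.carrier → ℂ} (hφ : IsUnitBounded φ)
    {ε : ℝ} (hφε : ∫ y, ‖f y - φ (p y)‖ ∂Y.μ ≤ ε) :
    ‖Y.cubeForm L f‖ ≤ (2 ^ L.length + 1) * ε := by
  have hφp : IsUnitBounded (fun y => φ (p y)) := hφ.comp hp.measurePreserving.measurable
  obtain ⟨v, hvm, hvb, hv⟩ := B.exists_cubesLift_eq_mul L hφ
  set w : Y.carrier → ℂ := fun y => v (q y)
  have hwb : IsUnitBounded w := hvb.comp hq.measurePreserving.measurable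
  have hwm : Measurable[pleasantFactor Y.μ Y.T] w := by
    have h1 : Measurable[⨆ k ∈ L, Y.isotropy k, ⨆ k ∈ L, (B.cubes L).isotropy k] q := by
      rw [measurable_iff_comap_le]
      simp only [MeasurableSpace.comap_iSup]
      exact iSup₂_mono fun k _ => (hq.measurable_isotropy k).comap_le
    exact (hvm.comp h1).mono (iSup₂_le fun k _ => Y.isotropy_le_pleasantFactor k) le_rfl
  have h0 : ∫ y, w y * f y ∂Y.μ = 0 := by
    rw [← integral_mul_condExp_of_measurable Y.pleasantFactor_le hwm hwb hf]
    refine integral_eq_zero_of_ae ?_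
    filter_upwards [hE] with y hy
    simp [hy]
  have h1 : Y.cubeForm L (fun y => φ (p y)) = ∫ y, w y * φ (p y) ∂Y.μ := by
    rw [hp.cubeForm_comp L hφ, cubeForm]
    simp only [hv]
    have := integral_comp_measurePreserving hq.measurePreserving
      (f := fun z => φ (B.base L z) * v z)
      ((hφ.comp (B.isExtension_base L).measurePreserving.measurable).mul
        hvb).measurable.aestronglyMeasurable
    refine this.symm.trans (integral_congr_ae (Eventually.of_forall fun y => ?_))
    simp only [hpq, w]
    rw [mul_comm]
  have hdi : Integrable (fun y => ‖f y - φ (p y)‖) Y.μ :=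
    ((hf.integrable _).sub (hφp.integrable _)).norm
  have h2 : ‖∫ y, w y * φ (p y) ∂Y.μ‖ ≤ ε := by
    have e : ∫ y, w y * φ (p y) ∂Y.μ = ∫ y, -(w y * (f y - φ (p y))) ∂Y.μ := by
      rw [integral_neg]
      simp only [mul_sub]
      rw [integral_sub ((hwb.mul hf).integrable _) ((hwb.mul hφp).integrable _), h0]
      simp
    rw [e]
    refine (norm_integral_le_integral_norm _).trans (le_trans ?_ hφε)
    refine integral_mono_of_nonneg (Eventually.of_forall fun y => norm_nonneg _) hdi
      (Eventually.of_forall fun y => ?_)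
    simp only [norm_neg, norm_mul]
    exact mul_le_of_le_one_left (norm_nonneg _) (hwb.norm_le y)
  have h3 : ‖Y.cubeForm L f - Y.cubeForm L (fun y => φ (p y))‖ ≤ 2 ^ L.length * ε := by
    rw [cubeForm, cubeForm, ← integral_sub ((hf.cubesLift L).integrable _)
      ((hφp.cubesLift L).integrable _)]
    refine (norm_integral_le_integral_norm _).trans
      ((Y.integral_norm_cubesLift_sub_le L hf hφp).trans ?_)
    exact mul_le_mul_of_nonneg_left hφε (by positivity)
  calc ‖Y.cubeForm L f‖ = ‖(Y.cubeForm L f - Y.cubeForm L (fun y => φ (p y)))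
        + ∫ y, w y * φ (p y) ∂Y.μ‖ := by rw [← h1, sub_add_cancel]
    _ ≤ 2 ^ L.length * ε + ε := (norm_add_le _ _).trans (add_le_add h3 h2)
    _ = _ := by ring

/-- Every system has an extension in which functions with vanishing conditional expectation
on the pleasant factor have vanishing cube form. -/
lemma exists_extension_cubeForm_eq_zero (A : MPSystem.{u} r d) (L : List (Fin d)) :
    ∃ (Y : MPSystem.{u} r d) (ψ : Y.carrier → A.carrier), IsExtension Y A ψ ∧
      ∀ f : Y.carrier → ℂ, Measurable f → (∀ y, ‖f y‖ ≤ 1 / 2) →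
        Y.μ[f | pleasantFactor Y.μ Y.T] =ᵐ[Y.μ] 0 → Y.cubeForm L f = 0 := by
  obtain ⟨Y, p, hp, hcons, hmono, hgen⟩ := exists_inverseLimit (A.cubeTower L)
    (fun n => (A.cubeTower L n).base L) (fun n => (A.cubeTower L n).isExtension_base L)
  refine ⟨Y, p 0, hp 0, fun f hf hf' hE => ?_⟩
  have hsmall : ∀ ε : ℝ, 0 < ε → ‖Y.cubeForm L f‖ ≤ (2 ^ L.length + 1) * ε := by
    intro ε hε
    obtain ⟨n, φ, hφ, hφε⟩ := exists_approx_of_iSup_comap (ν := Y.μ)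
      (fun n => (hp n).measurePreserving.measurable) hmono hgen hf hf' hε
    exact norm_cubeForm_le_of_approx (hp n) (hp (n + 1)) (hcons n)
      ⟨hf, fun y => (hf' y).trans (by norm_num)⟩ hE hφ hφε
  have hlim : Tendsto (fun ε : ℝ => ((2 : ℝ) ^ L.length + 1) * ε) (𝓝[>] 0) (𝓝 0) := by
    have : Tendsto (fun ε : ℝ => ((2 : ℝ) ^ L.length + 1) * ε) (𝓝 0)
        (𝓝 (((2 : ℝ) ^ L.length + 1) * 0)) := tendsto_id.const_mul _
    rw [mul_zero] at this
    exact this.mono_left nhdsWithin_le_nhds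
  exact norm_le_zero_iff.1 (ge_of_tendsto hlim (eventually_mem_nhdsWithin.mono hsmall))

end MPSystem

/-! ### Pleasant extensions -/

open scoped Pointwise in
lemma isFolnerSeq_of_isAddFoelner {r : ℕ} {I : ℕ → Finset (Fin r → ℤ)}
    (hI : IsAddFoelner (Fin r → ℤ) (Measure.count : Measure (Fin r → ℤ)) atTop
      (fun N => (I N : Set (Fin r → ℤ)))) : IsFolnerSeq I where
  eventually_nonempty := by
    filter_upwards [hI.eventually_meas_ne_zero] with N hN
    rw [Finset.nonempty_iff_ne_empty]
    rintro h
    simp [h] at hN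
  tendsto_symmDiff h := by
    have h1 := (ENNReal.tendsto_toReal ENNReal.zero_ne_top).comp (hI.tendsto_meas_vadd_symmDiff h)
    refine h1.congr fun N => ?_
    have e : (h +ᵥ (I N : Set (Fin r → ℤ))) ∆ (I N : Set (Fin r → ℤ))
        = (((I N).map (addRightEmbedding h) ∆ I N : Finset (Fin r → ℤ)) : Set (Fin r → ℤ)) := by
      rw [Finset.coe_symmDiff]
      congr 1
      ext n
      simp only [Set.mem_vadd_set, vadd_eq_add, Finset.coe_map, Set.mem_image, Finset.mem_coe,
        addRightEmbedding_apply, add_comm]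
    simp only [Function.comp]
    rw [e, Measure.count_apply_finset, Measure.count_apply_finset, ENNReal.toReal_div]
    simp

section FactorAlgebra

variable {r d : ℕ} {X : Type u} [m₀ : MeasurableSpace X] {μ : Measure X}
  {T : ZGroup r d → X → X}

lemma isotropyFactor_invariant (hT : IsPreservingAction μ T) (Γ : AddSubgroup (ZGroup r d))
    (g : ZGroup r d) : isotropyFactor μ T Γ ≤ (isotropyFactor μ T Γ).map (T g) := by
  intro A hA
  refine ⟨(hT.measurePreserving g).measurable hA.1, fun γ hγ => ?_⟩
  have e : T γ ⁻¹' (T g ⁻¹' A) = T g ⁻¹' (T γ ⁻¹' A) := by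
    ext x
    simp only [Set.mem_preimage]
    rw [← hT.map_add, ← hT.map_add, add_comm]
  rw [e]
  exact (hT.measurePreserving g).quasiMeasurePreserving.ae_eq (hA.2 γ hγ)

lemma isFactorAlgebra_pleasantFactor [NeZero d] (hT : IsPreservingAction μ T) :
    IsFactorAlgebra μ T (pleasantFactor μ T) where
  le := sup_le isotropyFactor_le (iSup₂_le fun _ _ => isotropyFactor_le)
  invariant g := by
    have h : pleasantFactor μ T ≤ (pleasantFactor μ T).map (T g) := by
      refine sup_le ((isotropyFactor_invariant hT _ g).trans (MeasurableSpace.map_mono le_sup_left))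
        (iSup₂_le fun i hi => (isotropyFactor_invariant hT _ g).trans (MeasurableSpace.map_mono ?_))
      exact le_sup_of_le_right (le_iSup₂_of_le i hi le_rfl)
    exact fun A hA => h A hA
  complete A hA h0 := by
    have h : MeasurableSet[isotropyFactor μ T (blockEmb (r := r) (0 : Fin d)).range] A := by
      refine ⟨hA, fun γ _ => ?_⟩
      have h1 := (hT.measurePreserving γ).quasiMeasurePreserving.ae_eq (ae_eq_empty.2 h0)
      exact h1.trans (ae_eq_empty.2 h0).symm
    exact (le_sup_left : _ ≤ pleasantFactor μ T) A h

lemma isFactorAlgebra_top (hT : IsPreservingAction μ T) : IsFactorAlgebra μ T m₀ :=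
  ⟨le_rfl, fun g _ hA => (hT.measurePreserving g).measurable hA, fun _ hA _ => hA⟩

end FactorAlgebra

/-- An essentially bounded function is almost everywhere a multiple of a measurable function
bounded by `1 / 2` everywhere. -/
lemma exists_ae_eq_smul_of_memLp_top {X : Type*} [MeasurableSpace X] {μ : Measure X}
    {f : X → ℂ} (hf : MemLp f ⊤ μ) :
    ∃ (c : ℝ) (h : X → ℂ), c ≠ 0 ∧ Measurable h ∧ (∀ x, ‖h x‖ ≤ 1 / 2) ∧
      f =ᵐ[μ] fun x => (c : ℂ) * h x := by
  have hfin : eLpNorm f ⊤ μ ≠ ⊤ := hf.eLpNorm_ne_top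
  rw [eLpNorm_exponent_top] at hfin
  set C : ℝ := (eLpNormEssSup f μ).toReal
  have hC : ∀ᵐ x ∂μ, ‖f x‖ ≤ C := by
    filter_upwards [ae_le_eLpNormEssSup (f := f) (μ := μ)] with x hx
    simpa using ENNReal.toReal_mono hfin hx
  obtain ⟨g, hg, hfg⟩ := hf.1
  set c : ℝ := 2 * (|C| + 1)
  have hc : 0 < c := by positivity
  set s : Set X := {x | ‖g x‖ ≤ |C| + 1}
  have hs : MeasurableSet s := measurableSet_le hg.measurable.norm measurable_const
  refine ⟨c, s.indicator fun x => (c : ℂ)⁻¹ * g x, hc.ne',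
    (hg.measurable.const_mul _).indicator hs, fun x => ?_, ?_⟩
  · by_cases hx : x ∈ s
    · rw [Set.indicator_of_mem hx, norm_mul, norm_inv, Complex.norm_real, Real.norm_eq_abs,
        abs_of_pos hc, inv_mul_le_iff₀ hc]
      refine le_trans hx (le_of_eq ?_)
      simp only [c]; ring
    · simp [hx]
  · filter_upwards [hC, hfg] with x h1 h2
    have hx : x ∈ s := by
      simp only [s, Set.mem_ofPred_eq, ← h2]
      linarith [le_abs_self C]
    rw [Set.indicator_of_mem hx, ← mul_assoc, mul_inv_cancel₀ (by exact_mod_cast hc.ne'), one_mul, h2]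

namespace MPSystem

variable {r d : ℕ} [NeZero d]

/-- The indices other than `0`, as a list. -/
noncomputable def otherIndices (d : ℕ) [NeZero d] : List (Fin d) :=
  (Finset.univ.erase (0 : Fin d)).toList

lemma nodup_cons_otherIndices : ((0 : Fin d) :: otherIndices d).Nodup := by
  simp [otherIndices, Finset.nodup_toList]

lemma nonconvAverage_eq_directionAverage (A : MPSystem.{u} r d) (I : Finset (Fin r → ℤ))
    (a : Fin r → ℤ) (f : Fin d → A.carrier → ℂ) (x : A.carrier) :
    nonconvAverage A.T I a f x
      = A.directionAverage 0 (otherIndices d) (f 0) f (I.map (addRightEmbedding a)) x := by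
  unfold nonconvAverage directionAverage finAvg
  rw [Finset.card_map, Finset.sum_map, Complex.real_smul]
  push_cast
  congr 1
  refine Finset.sum_congr rfl fun n _ => ?_
  have e0 : direction (r := r) (0 : Fin d) = blockEmb 0 := by simp [direction]
  rw [← Finset.mul_prod_erase _ _ (Finset.mem_univ (0 : Fin d)), otherIndices, Finset.prod_map_toList,
    addRightEmbedding_apply, e0, add_comm a n]
  congr 1
  refine Finset.prod_congr rfl fun i hi => ?_
  have e : (blockEmb 0 (n + a) - direction i (n + a) : ZGroup r d) = blockEmb i (n + a) := by
    simp only [direction, if_neg (Finset.ne_of_mem_erase hi), AddMonoidHom.sub_apply]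
    abel
  rw [e]

/-- If functions orthogonal to the pleasant factor have vanishing cube form, the system is pleasant. -/
lemma isPleasant_of_cubeForm_eq_zero (Y : MPSystem.{u} r d)
    (hY : ∀ f : Y.carrier → ℂ, Measurable f → (∀ y, ‖f y‖ ≤ 1 / 2) →
      Y.μ[f | pleasantFactor Y.μ Y.T] =ᵐ[Y.μ] 0 → Y.cubeForm (0 :: otherIndices d) f = 0) :
    IsPleasant Y.μ Y.T where
  isFactorAlgebra i := by
    split_ifs
    · exact isFactorAlgebra_pleasantFactor Y.isAction
    · exact isFactorAlgebra_top Y.isAction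
  tendsto f hf I hI a := by
    have hW : pleasantFactor Y.μ Y.T ≤ Y.measurableSpace := Y.pleasantFactor_le
    set f' : Fin d → Y.carrier → ℂ := fun i => Y.μ[f i | if i = 0 then pleasantFactor Y.μ Y.T else Y.measurableSpace]
    have hint : ∀ i, Integrable (f i) Y.μ := fun i => (hf i).integrable le_top
    have hf'0 : f' 0 = Y.μ[f 0 | pleasantFactor Y.μ Y.T] := by simp [f']
    have hf' : ∀ i, i ≠ 0 → f' i =ᵐ[Y.μ] f i := fun i hi => by
      simp only [f', if_neg hi]
      exact condExp_of_aestronglyMeasurable' le_rfl (hint i).aestronglyMeasurable (hint i)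
    -- only the first function matters: replace it by its part orthogonal to the pleasant factor
    set F : Fin d → Y.carrier → ℂ := fun i => if i = 0 then fun x => f 0 x - f' 0 x else f i with hF
    have hFtop : ∀ i, MemLp (F i) ⊤ Y.μ := fun i => by
      by_cases hi : i = 0
      · simp only [F, if_pos hi, hf'0]
        exact (hf 0).sub ((hf 0).condExp le_top)
      · simpa only [F, if_neg hi] using hf i
    choose c h hc0 hhm hh hFh using fun i => exists_ae_eq_smul_of_memLp_top (hFtop i)
    have hhb : ∀ i, IsUnitBounded (h i) := fun i => ⟨hhm i, fun y => (hh i y).trans (by norm_num)⟩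
    have hE : Y.μ[h 0 | pleasantFactor Y.μ Y.T] =ᵐ[Y.μ] 0 := by
      have h1 : h 0 =ᵐ[Y.μ] (c 0)⁻¹ • (f 0 - Y.μ[f 0 | pleasantFactor Y.μ Y.T]) := by
        filter_upwards [hFh 0] with x hx
        simp only [F, if_pos, hf'0] at hx
        rw [Pi.smul_apply, Pi.sub_apply, hx, Complex.real_smul, ← mul_assoc, Complex.ofReal_inv,
          inv_mul_cancel₀ (by exact_mod_cast hc0 0), one_mul]
      have h2 := condExp_sub (m := pleasantFactor Y.μ Y.T) (hint 0) (integrable_condExp (m := pleasantFactor Y.μ Y.T) (μ := Y.μ) (f := f 0))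
      rw [condExp_of_stronglyMeasurable hW stronglyMeasurable_condExp integrable_condExp] at h2
      refine (condExp_congr_ae h1).trans ((condExp_smul _ _ _).trans ?_)
      filter_upwards [h2] with x hx
      simp [hx]
    have hQ := hY (h 0) (hhm 0) (hh 0) hE
    set J : ℕ → Finset (Fin r → ℤ) := fun N => (I N).map (addRightEmbedding (a N))
    have hJ : IsFolnerSeq J := (isFolnerSeq_of_isAddFoelner hI).translate a
    set D : ℕ → Y.carrier → ℂ := fun N => Y.directionAverage 0 (otherIndices d) (h 0) h (J N)
    have hD : ∀ N, IsUnitBounded (D N) := fun N =>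
      Y.isUnitBounded_directionAverage 0 _ (hhb 0) hhb (J N)
    have hlim : Tendsto (fun N => ∫ x, ‖D N x‖ ^ 2 ∂Y.μ) atTop (𝓝 0) := by
      refine tendsto_order.2 ⟨fun b hb => Eventually.of_forall fun N => hb.trans_le
        (integral_nonneg fun x => by positivity), fun b hb => ?_⟩
      have := Y.eventually_integral_norm_directionAverage_sq_le (otherIndices d) 0
        nodup_cons_otherIndices hJ (hhb 0) hhb (half_pos hb).le (by
          rw [hQ]; simp only [Complex.zero_re]; positivity)
      filter_upwards [this] with N hN
      exact hN.trans_lt (half_lt_self hb)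
    have hcoord : ∀ᵐ x ∂Y.μ, ∀ (g : ZGroup r d) (i : Fin d),
        F i (Y.T g x) = c i * h i (Y.T g x) ∧ (i ≠ 0 → f' i (Y.T g x) = f i (Y.T g x)) := by
      rw [ae_all_iff]
      intro g
      rw [ae_all_iff]
      intro i
      have hq := (Y.isAction.measurePreserving g).quasiMeasurePreserving
      have h1 := hq.ae_eq (hFh i)
      by_cases hi : i = 0
      · filter_upwards [h1] with x hx
        exact ⟨hx, fun hi' => absurd hi hi'⟩
      · filter_upwards [h1, hq.ae_eq (hf' i hi)] with x hx hx'
        exact ⟨hx, fun _ => hx'⟩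
    have heq : ∀ N, (fun x => nonconvAverage Y.T (I N) (a N) f x
        - nonconvAverage Y.T (I N) (a N) f' x)
        =ᵐ[Y.μ] (∏ i, (c i : ℂ)) • D N := by
      intro N
      filter_upwards [hcoord] with x hx
      rw [Pi.smul_apply, smul_eq_mul]
      simp only [D, J]
      rw [← nonconvAverage_eq_directionAverage]
      unfold nonconvAverage
      rw [← mul_sub, ← Finset.sum_sub_distrib, mul_left_comm]
      congr 1
      rw [Finset.mul_sum]
      refine Finset.sum_congr rfl fun n _ => ?_
      rw [← Finset.prod_mul_distrib]
      have e1 : ∏ i, (c i : ℂ) * h i (Y.T (blockEmb i (a N + n)) x)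
          = ∏ i, F i (Y.T (blockEmb i (a N + n)) x) :=
        Finset.prod_congr rfl fun i _ => ((hx _ i).1).symm
      rw [e1, ← Finset.mul_prod_erase _ _ (Finset.mem_univ (0 : Fin d)),
        ← Finset.mul_prod_erase _ (fun i => f' i _) (Finset.mem_univ (0 : Fin d)),
        ← Finset.mul_prod_erase _ (fun i => F i _) (Finset.mem_univ (0 : Fin d))]
      have e2 : ∏ i ∈ Finset.univ.erase (0 : Fin d), f' i (Y.T (blockEmb i (a N + n)) x)
          = ∏ i ∈ Finset.univ.erase (0 : Fin d), f i (Y.T (blockEmb i (a N + n)) x) :=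
        Finset.prod_congr rfl fun i hi => (hx _ i).2 (Finset.ne_of_mem_erase hi)
      have e3 : ∏ i ∈ Finset.univ.erase (0 : Fin d), F i (Y.T (blockEmb i (a N + n)) x)
          = ∏ i ∈ Finset.univ.erase (0 : Fin d), f i (Y.T (blockEmb i (a N + n)) x) :=
        Finset.prod_congr rfl fun i hi => by
          simp only [F, if_neg (Finset.ne_of_mem_erase hi)]
      rw [e2, e3, ← sub_mul]
      simp only [F, if_pos]
    have hnorm : ∀ N, eLpNorm (fun x => nonconvAverage Y.T (I N) (a N) f x
        - nonconvAverage Y.T (I N) (a N) f' x) 2 Y.μ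
        = ‖∏ i, (c i : ℂ)‖ₑ * ENNReal.ofReal (√(∫ x, ‖D N x‖ ^ 2 ∂Y.μ)) := by
      intro N
      rw [eLpNorm_congr_ae (heq N), eLpNorm_const_smul,
        ((hD N).memLp Y.μ 2).eLpNorm_eq_integral_rpow_norm two_ne_zero ENNReal.ofNat_ne_top]
      simp [Real.sqrt_eq_rpow]
    change Tendsto (fun N => eLpNorm (fun x => nonconvAverage Y.T (I N) (a N) f x
        - nonconvAverage Y.T (I N) (a N) f' x) 2 Y.μ) atTop (𝓝 0)
    simp only [hnorm]
    have h1 := ENNReal.tendsto_ofReal ((Real.continuous_sqrt.tendsto 0).comp hlim)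
    have h2 := ENNReal.Tendsto.const_mul (a := ‖∏ i, (c i : ℂ)‖ₑ) h1 (Or.inr enorm_ne_top)
    simpa using h2

end MPSystem

theorem proposition4p6 (r d : ℕ) [NeZero d] (X : Type u) [MeasurableSpace X]
    [StandardBorelSpace X] (μ : Measure X) [IsProbabilityMeasure μ]
    (T : ZGroup r d → X → X) (hT : IsPreservingAction μ T) :
    ∃ (Y : Type u) (_ : MeasurableSpace Y) (ν : Measure Y) (S : ZGroup r d → Y → Y) (ψ : Y → X),
      StandardBorelSpace Y ∧ IsProbabilityMeasure ν ∧ IsPreservingAction ν S ∧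
        IsExtensionMap ν S μ T ψ ∧ IsPleasant ν S := by
  obtain ⟨Y, ψ, hψ, hY⟩ := MPSystem.exists_extension_cubeForm_eq_zero ⟨X, μ, T, hT⟩
    (0 :: MPSystem.otherIndices d)
  exact ⟨Y.carrier, Y.measurableSpace, Y.μ, Y.T, ψ, Y.standardBorel, Y.isProbability, Y.isAction,
    hψ, Y.isPleasant_of_cubeForm_eq_zero hY⟩
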